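/- \textbf{Conventions.} A \emph{probability charge} on a Boolean algebra $\mathcal A$ of subsets of $X$ is a finitely additive $\mu:\mathcal A\to[0,1]$ with $\mu(X)=1$; it is an \emph{ultracharge} if $\mathcal A$ is the full power set. The integral of a bounded function with respect to a charge is the common value of its lower and upper integrals, defined by finite step functions with level sets in $\mathcal A$. For a metric space $M$, a \emph{Borel charge} is a probability charge on the Boolean algebra $\mathcal A(M)$ generated by the open sets; it is \emph{regular} if $\mu(A)=\sup\{\mu(F):F\subseteq A\text{ closed},\,F\in\mathcal A(M)\}=\inf\{\mu(G):A\subseteq G\text{ open},\,G\in\mathcal A(M)\}$ for all $A\in\mathcal A(M)$. Let $L$ be a Lipschitz language: each function symbol $F$ and relation symbol $R$ has a constant $\lambda_F,\lambda_R\ge 0$ (constant symbols are $0$-ary function symbols). An $L_\mu$-\emph{prestructure} is a pseudometric space $(M,\rho)$ with $\rho\le 1$, with a $\lambda_F$-Lipschitz map $F^M:M^n\to M$ and a $\lambda_R$-Lipschitz map $R^M:M^n\to[0,1]$ for all $n$-ary symbols $F,R$ (where $M^n$ carries $\sum_k\rho(a_k,b_k)$), and with a regular Borel charge $\mu$. It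 is an $L_\mu$-\emph{structure} if $\rho$ is a complete metric. The $\mathrm{AL}_{\int}$-\emph{formulas} are built from $1$, $\rho(t_1,t_2)$ and $R(t_1,\dots,t_n)$ ($t_k$ terms) by addition, multiplication by real scalars, and the quantifiers $\inf_x$, $\sup_x$, $\int\cdot\,dx$, which are interpreted in $M$ by infimum over $M$, supremum over $M$ and integration with respect to $\mu$. Let $\wp$ be an ultracharge on a set $I$ and let $(M_i,\rho_i,\mu_i)$, $i\in I$, be $L_\mu$-structures. The \emph{ultramean} $M=\prod_\wp M_i$ is the quotient metric space of $\prod_i M_i$ with the pseudometric $\rho(a,b)=\int_I\rho_i(a_i,b_i)\,d\wp$, with $F^M([a^1_i],\dots,[a^n_i])=[F^{M_i}(a_i^1,\dots,a_i^n)]$ and $R^M([a_i^1],\dots,[a_i^n])=\int_I R^{M_i}(a_i^1,\dots,a_i^n)\,d\wp$. If $f_i:M_i\to\mathbb R$ ($i\in I$) are all $\lambda$-Lipschitz and bounded by $\mathbf b$, with $\lambda,\mathbf b$ independent of $i$, let $[f_i]:M\to\mathbb R$ be the function $[f_i]([x_i])=\int_I f_i(x_i)\,d\wp$. \textbf{Theorem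 (Ultramean).} (1) There is a positive linear functional $\Phi$ on the space $\mathbf C_b(M)$ of bounded continuous functions $M\to\mathbb R$ with $\Phi([f_i])=\int_I\int_{M_i} f_i\,d\mu_i\,d\wp$ for all such families $(f_i)$. For every such $\Phi$ there is a regular Borel charge $\mu$ on $M$ with $\int_M g\,d\mu=\Phi(g)$ for all $g\in\mathbf C_b(M)$; in particular, for all such families $(f_i)$, $$\int_M [f_i]\,d\mu=\int_I\Big(\int_{M_i} f_i\,d\mu_i\Big)d\wp.\qquad(\dagger)$$ (2) For every regular Borel charge $\mu$ on $M$ satisfying $(\dagger)$, every $\mathrm{AL}_{\int}$-formula $\phi(x_1,\dots,x_n)$ and all $[a^1_i],\dots,[a^n_i]\in M$, the bounded function $i\mapsto\phi^{M_i}(a^1_i,\dots,a^n_i)$ is $\wp$-integrable and, in the prestructure $(M,\mu)$, $$\phi^M([a^1_i],\dots,[a^n_i])=\int_I\phi^{M_i}(a^1_i,\dots,a^n_i)\,d\wp.$$ (3) If $M_i=N$ for all $i$, where $N$ is an $L_\mu$-structure, then for every regular Borel charge $\mu$ satisfying $(\dagger)$ on the powermean $N^\wp=\prod_\wp N$, the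 diagonal map $a\mapsto[a]$ is an elementary embedding of $N$ into $(N^\wp,\mu)$: $\phi^N(a_1,\dots,a_n)=\phi^{N^\wp}([a_1],\dots,[a_n])$ for every $\mathrm{AL}_{\int}$-formula $\phi$ and all $a_1,\dots,a_n\in N$. -/

import Mathlib

open Set MeasureTheory
open scoped NNReal

namespace AffineIntegration

/-! ### Charges and integration with respect to a charge -/

/-- A probability charge on a Boolean algebra `C` of subsets of `X`: a nonnegative finitely additive
set function on `C` of total mass `1` (only the values on members of `C` carry information). -/
structure Charge {X : Type*} (C : Set (Set X)) where
  isSetAlgebra : IsSetAlgebra C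
  content : AddContent ℝ≥0 C
  content_univ : content univ = 1

/-- An ultracharge is a probability charge on the whole power set. -/
abbrev Ultracharge (I : Type*) := Charge (univ : Set (Set I))

namespace Charge

variable {X : Type*} {C : Set (Set X)}

/-- The value of a charge at a set, as a real number. -/
def real (μ : Charge C) (A : Set X) : ℝ := (μ.content A : ℝ)

/-- The integrals of the step functions below `f`. A step function is given by a finite partition
of `X` into members of `C` (the fibres of `π`, some of which may be empty) and its values `c`. -/
def lowerSums (μ : Charge C) (f : X → ℝ) : Set ℝ :=
  {r | ∃ (n : ℕ) (π : X → Fin n) (c : Fin n → ℝ), (∀ k, π ⁻¹' {k} ∈ C) ∧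
    (∀ x, c (π x) ≤ f x) ∧ r = ∑ k, c k * μ.real (π ⁻¹' {k})}

/-- The integrals of the step functions above `f`. -/
def upperSums (μ : Charge C) (f : X → ℝ) : Set ℝ :=
  {r | ∃ (n : ℕ) (π : X → Fin n) (c : Fin n → ℝ), (∀ k, π ⁻¹' {k} ∈ C) ∧
    (∀ x, f x ≤ c (π x)) ∧ r = ∑ k, c k * μ.real (π ⁻¹' {k})}

/-- The lower integral. -/
noncomputable def lowerIntegral (μ : Charge C) (f : X → ℝ) : ℝ := sSup (μ.lowerSums f)

/-- The upper integral. -/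
noncomputable def upperIntegral (μ : Charge C) (f : X → ℝ) : ℝ := sInf (μ.upperSums f)

/-- A bounded function is integrable if its lower and upper integrals agree. -/
def IsIntegrable (μ : Charge C) (f : X → ℝ) : Prop :=
  (∃ B : ℝ, ∀ x, |f x| ≤ B) ∧ μ.lowerIntegral f = μ.upperIntegral f

/-- The integral of an integrable function: the common value of the lower and upper integrals. -/
noncomputable def integral (μ : Charge C) (f : X → ℝ) : ℝ := μ.lowerIntegral f

theorem real_nonneg (μ : Charge C) (A : Set X) : 0 ≤ μ.real A := (μ.content A).2

theorem real_univ (μ : Charge C) : μ.real univ = 1 := by simp [real, μ.content_univ]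

theorem real_eq_sum (μ : Charge C) {ι : Type*} [Fintype ι] {π : X → ι}
    (hπ : ∀ k, π ⁻¹' {k} ∈ C) {A : Set X} (hA : A ∈ C) :
    μ.real A = ∑ k, μ.real (A ∩ π ⁻¹' {k}) := by
  have h : (⋃ k, A ∩ π ⁻¹' {k}) = A := by ext x; simp
  have := addContent_iUnion (m := μ.content) (f := fun k => A ∩ π ⁻¹' {k})
    (fun k => μ.isSetAlgebra.inter_mem hA (hπ k))
    (fun i j hij => by
      refine Set.disjoint_left.2 fun x hx hx' => hij ?_
      have h1 : π x = i := hx.2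
      have h2 : π x = j := hx'.2
      exact h1.symm.trans h2)
    (by rw [h]; exact hA)
  rw [h] at this
  simp only [real, this, NNReal.coe_sum]

theorem sum_real (μ : Charge C) {ι : Type*} [Fintype ι] {π : X → ι}
    (hπ : ∀ k, π ⁻¹' {k} ∈ C) : ∑ k, μ.real (π ⁻¹' {k}) = 1 := by
  rw [← μ.real_univ, μ.real_eq_sum hπ μ.isSetAlgebra.univ_mem]
  simp

theorem prod_mem (μ : Charge C) {ι κ : Type*} {π : X → ι} {σ : X → κ}
    (hπ : ∀ k, π ⁻¹' {k} ∈ C) (hσ : ∀ k, σ ⁻¹' {k} ∈ C) (k : ι × κ) :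
    (fun x => (π x, σ x)) ⁻¹' {k} ∈ C := by
  have : (fun x => (π x, σ x)) ⁻¹' {k} = π ⁻¹' {k.1} ∩ σ ⁻¹' {k.2} := by
    ext x; simp [Prod.ext_iff]
  rw [this]
  exact μ.isSetAlgebra.inter_mem (hπ _) (hσ _)

theorem sum_fst (μ : Charge C) {ι κ : Type*} [Fintype ι] [Fintype κ] {π : X → ι} {σ : X → κ}
    (hπ : ∀ k, π ⁻¹' {k} ∈ C) (hσ : ∀ k, σ ⁻¹' {k} ∈ C) (c : ι → ℝ) :
    ∑ k, c k * μ.real (π ⁻¹' {k}) =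
      ∑ k : ι × κ, c k.1 * μ.real ((fun x => (π x, σ x)) ⁻¹' {k}) := by
  rw [Fintype.sum_prod_type]
  refine Finset.sum_congr rfl fun k _ => ?_
  rw [μ.real_eq_sum hσ (hπ k), Finset.mul_sum]
  refine Finset.sum_congr rfl fun l _ => ?_
  congr 2
  ext x; simp [Prod.ext_iff]

theorem sum_snd (μ : Charge C) {ι κ : Type*} [Fintype ι] [Fintype κ] {π : X → ι} {σ : X → κ}
    (hπ : ∀ k, π ⁻¹' {k} ∈ C) (hσ : ∀ k, σ ⁻¹' {k} ∈ C) (c : κ → ℝ) :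
    ∑ k, c k * μ.real (σ ⁻¹' {k}) =
      ∑ k : ι × κ, c k.2 * μ.real ((fun x => (π x, σ x)) ⁻¹' {k}) := by
  rw [Fintype.sum_prod_type_right]
  refine Finset.sum_congr rfl fun k _ => ?_
  rw [μ.real_eq_sum hπ (hσ k), Finset.mul_sum]
  refine Finset.sum_congr rfl fun l _ => ?_
  congr 2
  ext x; simp [Prod.ext_iff, and_comm]

theorem mem_lowerSums (μ : Charge C) {f : X → ℝ} {ι : Type*} [Fintype ι] (π : X → ι) (c : ι → ℝ)
    (hπ : ∀ k, π ⁻¹' {k} ∈ C) (hc : ∀ x, c (π x) ≤ f x) :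
    ∑ k, c k * μ.real (π ⁻¹' {k}) ∈ μ.lowerSums f := by
  classical
  let e := Fintype.equivFin ι
  have he : ∀ k, (fun x => e (π x)) ⁻¹' {k} = π ⁻¹' {e.symm k} := by
    intro k; ext x; simp [Equiv.eq_symm_apply]
  refine ⟨Fintype.card ι, fun x => e (π x), fun k => c (e.symm k), fun k => ?_, fun x => ?_, ?_⟩
  · rw [he]; exact hπ _
  · simpa using hc x
  · simp only [he]
    exact (e.symm.sum_comp fun k => c k * μ.real (π ⁻¹' {k})).symm

theorem mem_upperSums (μ : Charge C) {f : X → ℝ} {ι : Type*} [Fintype ι] (π : X → ι) (c : ι → ℝ)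
    (hπ : ∀ k, π ⁻¹' {k} ∈ C) (hc : ∀ x, f x ≤ c (π x)) :
    ∑ k, c k * μ.real (π ⁻¹' {k}) ∈ μ.upperSums f := by
  classical
  let e := Fintype.equivFin ι
  have he : ∀ k, (fun x => e (π x)) ⁻¹' {k} = π ⁻¹' {e.symm k} := by
    intro k; ext x; simp [Equiv.eq_symm_apply]
  refine ⟨Fintype.card ι, fun x => e (π x), fun k => c (e.symm k), fun k => ?_, fun x => ?_, ?_⟩
  · rw [he]; exact hπ _
  · simpa using hc x
  · simp only [he]
    exact (e.symm.sum_comp fun k => c k * μ.real (π ⁻¹' {k})).symm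

theorem lower_le_upper (μ : Charge C) {f g : X → ℝ} (hfg : ∀ x, f x ≤ g x) {r s : ℝ}
    (hr : r ∈ μ.lowerSums f) (hs : s ∈ μ.upperSums g) : r ≤ s := by
  obtain ⟨n, π, c, hπ, hc, rfl⟩ := hr
  obtain ⟨m, σ, d, hσ, hd, rfl⟩ := hs
  rw [μ.sum_fst hπ hσ, μ.sum_snd hπ hσ]
  refine Finset.sum_le_sum fun k _ => ?_
  by_cases hk : ((fun x => (π x, σ x)) ⁻¹' {k}).Nonempty
  · obtain ⟨x, hx⟩ := hk
    have hx' : (π x, σ x) = k := hx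
    subst hx'
    exact mul_le_mul_of_nonneg_right ((hc x).trans ((hfg x).trans (hd x))) (μ.real_nonneg _)
  · rw [Set.not_nonempty_iff_eq_empty.1 hk]
    simp [real]

theorem const_mem_lowerSums (μ : Charge C) {f : X → ℝ} {b : ℝ} (h : ∀ x, b ≤ f x) :
    b ∈ μ.lowerSums f := by
  have hm : ∀ k : Unit, (fun _ : X => ()) ⁻¹' {k} ∈ C := fun k => by
    simpa using μ.isSetAlgebra.univ_mem
  simpa [μ.real_univ] using μ.mem_lowerSums (f := f) (fun _ => ()) (fun _ => b) hm h

theorem const_mem_upperSums (μ : Charge C) {f : X → ℝ} {b : ℝ} (h : ∀ x, f x ≤ b) :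
    b ∈ μ.upperSums f := by
  have hm : ∀ k : Unit, (fun _ : X => ()) ⁻¹' {k} ∈ C := fun k => by
    simpa using μ.isSetAlgebra.univ_mem
  simpa [μ.real_univ] using μ.mem_upperSums (f := f) (fun _ => ()) (fun _ => b) hm h

theorem bddAbove_lowerSums (μ : Charge C) {f : X → ℝ} {b : ℝ} (h : ∀ x, f x ≤ b) :
    BddAbove (μ.lowerSums f) :=
  ⟨b, fun _ hr => μ.lower_le_upper (fun _ => le_rfl) hr (μ.const_mem_upperSums h)⟩

theorem bddBelow_upperSums (μ : Charge C) {f : X → ℝ} {b : ℝ} (h : ∀ x, b ≤ f x) :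
    BddBelow (μ.upperSums f) :=
  ⟨b, fun _ hr => μ.lower_le_upper (fun _ => le_rfl) (μ.const_mem_lowerSums h) hr⟩

/-- A bounded function is integrable as soon as the preimages of half-open intervals are in the
algebra. -/
theorem isIntegrable_of_preimage_Ico (μ : Charge C) {f : X → ℝ} {B : ℝ} (hB : ∀ x, |f x| ≤ B)
    (hf : ∀ r s : ℝ, f ⁻¹' Ico r s ∈ C) : μ.IsIntegrable f := by
  have hlo : ∀ x, -B ≤ f x := fun x => (abs_le.1 (hB x)).1
  have hhi : ∀ x, f x ≤ B := fun x => (abs_le.1 (hB x)).2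
  refine ⟨⟨B, hB⟩, le_antisymm ?_ ?_⟩
  · exact csSup_le ⟨_, μ.const_mem_lowerSums hlo⟩ fun r hr =>
      le_csInf ⟨_, μ.const_mem_upperSums hhi⟩ fun s hs =>
        μ.lower_le_upper (fun _ => le_rfl) hr hs
  · refine le_of_forall_pos_le_add fun ε hε => ?_
    let a : ℤ := ⌊-B / ε⌋
    let b : ℤ := ⌊B / ε⌋
    have hmem : ∀ x, ⌊f x / ε⌋ ∈ Set.Icc a b := fun x =>
      ⟨Int.floor_le_floor (div_le_div_of_nonneg_right (hlo x) hε.le),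
        Int.floor_le_floor (div_le_div_of_nonneg_right (hhi x) hε.le)⟩
    let π : X → Set.Icc a b := fun x => ⟨⌊f x / ε⌋, hmem x⟩
    have hπ : ∀ k, π ⁻¹' {k} ∈ C := by
      intro k
      have : π ⁻¹' {k} = f ⁻¹' Ico (ε * (k : ℤ)) (ε * ((k : ℤ) + 1)) := by
        ext x
        simp only [π, mem_preimage, mem_singleton_iff, Subtype.ext_iff, Int.floor_eq_iff,
          le_div_iff₀ hε, div_lt_iff₀ hε, mem_Ico, mul_comm]
      rw [this]; exact hf _ _
    have h1 := μ.mem_lowerSums (f := f) π (fun k => ε * ((k : ℤ) : ℝ)) hπ (fun x => by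
      have := Int.floor_le (f x / ε)
      rw [le_div_iff₀ hε] at this
      simpa [π, mul_comm] using this)
    have h2 := μ.mem_upperSums (f := f) π (fun k => ε * ((k : ℤ) : ℝ) + ε) hπ (fun x => by
      have := (Int.lt_floor_add_one (f x / ε)).le
      rw [div_le_iff₀ hε] at this
      simp only [π]
      linarith)
    have h3 : ∑ k : Set.Icc a b, (ε * ((k : ℤ) : ℝ) + ε) * μ.real (π ⁻¹' {k}) =
        ∑ k : Set.Icc a b, (ε * ((k : ℤ) : ℝ)) * μ.real (π ⁻¹' {k}) + ε := by
      simp only [add_mul, Finset.sum_add_distrib, ← Finset.mul_sum, μ.sum_real hπ, mul_one]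
    calc μ.upperIntegral f ≤ _ := csInf_le (μ.bddBelow_upperSums hlo) h2
      _ = _ := h3
      _ ≤ μ.lowerIntegral f + ε := by
        have := le_csSup (μ.bddAbove_lowerSums hhi) h1
        unfold lowerIntegral
        linarith

theorem integral_mono (μ : Charge C) {f g : X → ℝ} {B : ℝ} (hf : ∀ x, |f x| ≤ B)
    (hg : ∀ x, |g x| ≤ B) (h : ∀ x, f x ≤ g x) : μ.integral f ≤ μ.integral g := by
  refine csSup_le_csSup (μ.bddAbove_lowerSums fun x => (abs_le.1 (hg x)).2)
    ⟨_, μ.const_mem_lowerSums fun x => (abs_le.1 (hf x)).1⟩ ?_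
  rintro r ⟨n, π, c, hπ, hc, rfl⟩
  exact μ.mem_lowerSums π c hπ fun x => (hc x).trans (h x)

theorem integral_const (μ : Charge C) (c : ℝ) : μ.integral (fun _ => c) = c :=
  le_antisymm
    (csSup_le ⟨c, μ.const_mem_lowerSums fun _ => le_rfl⟩ fun _ hr =>
      μ.lower_le_upper (fun _ => le_rfl) hr (μ.const_mem_upperSums fun _ => le_rfl))
    (le_csSup (μ.bddAbove_lowerSums fun _ => le_rfl) (μ.const_mem_lowerSums fun _ => le_rfl))

theorem abs_integral_le (μ : Charge C) {f : X → ℝ} {B : ℝ} (hf : ∀ x, |f x| ≤ B) :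
    |μ.integral f| ≤ B := by
  have hlo : ∀ x, -B ≤ f x := fun x => (abs_le.1 (hf x)).1
  have hhi : ∀ x, f x ≤ B := fun x => (abs_le.1 (hf x)).2
  exact abs_le.2 ⟨le_csSup (μ.bddAbove_lowerSums hhi) (μ.const_mem_lowerSums hlo),
    csSup_le ⟨_, μ.const_mem_lowerSums hlo⟩ fun _ hr =>
      μ.lower_le_upper (fun _ => le_rfl) hr (μ.const_mem_upperSums hhi)⟩

theorem upperIntegral_add_le (μ : Charge C) {f g : X → ℝ} {A B : ℝ} (hf : ∀ x, |f x| ≤ A)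
    (hg : ∀ x, |g x| ≤ B) :
    μ.upperIntegral (fun x => f x + g x) ≤ μ.upperIntegral f + μ.upperIntegral g := by
  have hfg : ∀ x, -(A + B) ≤ f x + g x := fun x => by
    linarith [(abs_le.1 (hf x)).1, (abs_le.1 (hg x)).1]
  have hnf : (μ.upperSums f).Nonempty := ⟨_, μ.const_mem_upperSums fun x => (abs_le.1 (hf x)).2⟩
  have hng : (μ.upperSums g).Nonempty := ⟨_, μ.const_mem_upperSums fun x => (abs_le.1 (hg x)).2⟩
  have key : ∀ r ∈ μ.upperSums f, ∀ s ∈ μ.upperSums g,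
      μ.upperIntegral (fun x => f x + g x) ≤ r + s := by
    rintro _ ⟨n, π, c, hπ, hc, rfl⟩ _ ⟨m, σ, d, hσ, hd, rfl⟩
    refine csInf_le (μ.bddBelow_upperSums hfg) ?_
    rw [μ.sum_fst hπ hσ, μ.sum_snd hπ hσ, ← Finset.sum_add_distrib]
    simp only [← add_mul]
    exact μ.mem_upperSums (fun x => (π x, σ x)) (fun k => c k.1 + d k.2) (μ.prod_mem hπ hσ)
      fun x => add_le_add (hc x) (hd x)
  have h1 : ∀ r ∈ μ.upperSums f, μ.upperIntegral (fun x => f x + g x) - r ≤ μ.upperIntegral g :=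
    fun r hr => le_csInf hng fun s hs => by linarith [key r hr s hs]
  have h2 : μ.upperIntegral (fun x => f x + g x) - μ.upperIntegral g ≤ μ.upperIntegral f :=
    le_csInf hnf fun r hr => by linarith [h1 r hr]
  linarith

theorem upperIntegral_mul_le (μ : Charge C) {f : X → ℝ} {B : ℝ} (hf : ∀ x, |f x| ≤ B)
    {r : ℝ} (hr : 0 ≤ r) : μ.upperIntegral (fun x => r * f x) ≤ r * μ.upperIntegral f := by
  have hnf : (μ.upperSums f).Nonempty := ⟨_, μ.const_mem_upperSums fun x => (abs_le.1 (hf x)).2⟩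
  have hb : ∀ x, r * -B ≤ r * f x := fun x => mul_le_mul_of_nonneg_left (abs_le.1 (hf x)).1 hr
  have key : ∀ s ∈ μ.upperSums f, μ.upperIntegral (fun x => r * f x) ≤ r * s := by
    rintro _ ⟨n, π, c, hπ, hc, rfl⟩
    refine csInf_le (μ.bddBelow_upperSums hb) ?_
    rw [Finset.mul_sum]
    simp only [← mul_assoc]
    exact μ.mem_upperSums π (fun k => r * c k) hπ fun x => mul_le_mul_of_nonneg_left (hc x) hr
  rcases hr.eq_or_lt with rfl | hr'
  · obtain ⟨s, hs⟩ := hnf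
    simpa using key s hs
  · rw [mul_comm, ← div_le_iff₀ hr']
    exact le_csInf hnf fun s hs => by
      rw [div_le_iff₀ hr', mul_comm]
      exact key s hs

end Charge

namespace Ultracharge

variable {I : Type*}

/-- Bounded functions are integrable with respect to an ultracharge. -/
theorem isIntegrable (P : Ultracharge I) {f : I → ℝ} {B : ℝ} (hf : ∀ i, |f i| ≤ B) :
    P.IsIntegrable f :=
  P.isIntegrable_of_preimage_Ico hf fun _ _ => mem_univ _

theorem integral_add_mul_le (P : Ultracharge I) {f g : I → ℝ} {A B r : ℝ} (hf : ∀ i, |f i| ≤ A)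
    (hg : ∀ i, |g i| ≤ B) (hr : 0 ≤ r) :
    P.integral (fun i => f i + r * g i) ≤ P.integral f + r * P.integral g := by
  have hrg : ∀ i, |r * g i| ≤ r * B := fun i => by
    rw [abs_mul, abs_of_nonneg hr]; exact mul_le_mul_of_nonneg_left (hg i) hr
  have hs : ∀ i, |f i + r * g i| ≤ A + r * B := fun i =>
    (abs_add_le _ _).trans (add_le_add (hf i) (hrg i))
  have e1 : P.integral (fun i => f i + r * g i) = _ := (P.isIntegrable hs).2
  have e2 : P.integral f = _ := (P.isIntegrable hf).2
  have e3 : P.integral g = _ := (P.isIntegrable hg).2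
  rw [e1, e2, e3]
  exact (P.upperIntegral_add_le hf hrg).trans
    (add_le_add le_rfl (P.upperIntegral_mul_le hg hr))

theorem integral_sum_le (P : Ultracharge I) {κ : Type*} (s : Finset κ) {g : κ → I → ℝ}
    (hg : ∀ k i, |g k i| ≤ 1) :
    P.integral (fun i => ∑ k ∈ s, g k i) ≤ ∑ k ∈ s, P.integral (g k) := by
  classical
  induction s using Finset.induction_on with
  | empty => simpa using (P.integral_const 0).le
  | insert k s hk ih =>
    simp only [Finset.sum_insert hk]
    have hb : ∀ i, |∑ k ∈ s, g k i| ≤ ∑ k ∈ s, (1 : ℝ) := fun i =>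
      (Finset.abs_sum_le_sum_abs _ _).trans (Finset.sum_le_sum fun k _ => hg k i)
    have := P.integral_add_mul_le (hg k) hb (zero_le_one' ℝ)
    simp only [one_mul] at this
    linarith

/-- If `f ≤ g + r (h₁ + ⋯ + hₙ)` pointwise, then the same holds for the integrals. -/
theorem integral_le_of_le (P : Ultracharge I) {n : ℕ} {f g : I → ℝ} {h : Fin n → I → ℝ}
    {B r : ℝ} (hf : ∀ i, |f i| ≤ B) (hg : ∀ i, |g i| ≤ B) (hh : ∀ k i, |h k i| ≤ 1)
    (hr : 0 ≤ r) (hle : ∀ i, f i ≤ g i + r * ∑ k, h k i) :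
    P.integral f ≤ P.integral g + r * ∑ k, P.integral (h k) := by
  have hb : ∀ i, |∑ k, h k i| ≤ ∑ k : Fin n, (1 : ℝ) := fun i =>
    (Finset.abs_sum_le_sum_abs _ _).trans (Finset.sum_le_sum fun k _ => hh k i)
  have hb' : ∀ i, |g i + r * ∑ k, h k i| ≤ B + r * ∑ k : Fin n, (1 : ℝ) := fun i =>
    (abs_add_le _ _).trans (add_le_add (hg i) (by
      rw [abs_mul, abs_of_nonneg hr]; exact mul_le_mul_of_nonneg_left (hb i) hr))
  have hf' : ∀ i, |f i| ≤ B + r * ∑ k : Fin n, (1 : ℝ) := fun i =>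
    (hf i).trans (le_add_of_nonneg_right (mul_nonneg hr (Finset.sum_nonneg fun _ _ => zero_le_one)))
  calc P.integral f ≤ _ := P.integral_mono hf' hb' hle
    _ ≤ _ := P.integral_add_mul_le hg hb hr
    _ ≤ _ := by
      have := P.integral_sum_le Finset.univ hh
      nlinarith [mul_le_mul_of_nonneg_left this hr]

end Ultracharge

/-! ### Languages, prestructures and structures -/

/-- A Lipschitz language: function and relation symbols carry Lipschitz constants. Constant symbols
are the function symbols of arity `0`. The metric symbol and the charge symbol are logical symbols
and hence are not listed. -/
structure LipschitzLanguage.{u, v} extends FirstOrder.Language.{u, v} where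
  funLip : ∀ {n : ℕ}, Functions n → ℝ≥0
  relLip : ∀ {n : ℕ}, Relations n → ℝ≥0

/-- The Borel algebra of a space: the Boolean algebra (not `σ`-algebra) generated by open sets. -/
def borelAlgebra (M : Type*) [TopologicalSpace M] : Set (Set M) :=
  generateSetAlgebra {U : Set M | IsOpen U}

/-- A Borel charge: a probability charge on the Borel algebra. -/
abbrev BorelCharge (M : Type*) [TopologicalSpace M] := Charge (borelAlgebra M)

/-- Inner regularity with respect to closed sets and outer regularity with respect to open sets. -/
def BorelCharge.IsRegular {M : Type*} [TopologicalSpace M] (μ : BorelCharge M) : Prop :=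
  ∀ A ∈ borelAlgebra M,
    IsLUB {r | ∃ F ∈ borelAlgebra M, F ⊆ A ∧ IsClosed F ∧ r = μ.real F} (μ.real A) ∧
    IsGLB {r | ∃ G ∈ borelAlgebra M, A ⊆ G ∧ IsOpen G ∧ r = μ.real G} (μ.real A)

/-- Bounded continuous functions are integrable with respect to every Borel charge. -/
theorem BorelCharge.isIntegrable {M : Type*} [TopologicalSpace M] (μ : BorelCharge M) {f : M → ℝ}
    (hf : Continuous f) {B : ℝ} (hB : ∀ x, |f x| ≤ B) : μ.IsIntegrable f := by
  refine μ.isIntegrable_of_preimage_Ico hB fun r s => ?_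
  have h : ∀ t : ℝ, f ⁻¹' Iio t ∈ borelAlgebra M := fun t =>
    self_subset_generateSetAlgebra (isOpen_Iio.preimage hf)
  have e : f ⁻¹' Ico r s = f ⁻¹' Iio s \ f ⁻¹' Iio r := by
    ext x; simp [and_comm]
  rw [e]
  exact μ.isSetAlgebra.sdiff_mem (h s) (h r)

/-- The part of a prestructure that does not involve the charge. The metric is a relation with
values in `[0, 1]`, and `Mⁿ` carries the sum pseudometric. -/
structure MetricPrestructure.{u, v, w} (L : LipschitzLanguage.{u, v}) (M : Type w)
    [PseudoMetricSpace M] where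
  dist_le_one : ∀ x y : M, dist x y ≤ 1
  funMap : ∀ {n : ℕ}, L.Functions n → (Fin n → M) → M
  relMap : ∀ {n : ℕ}, L.Relations n → (Fin n → M) → ℝ
  dist_funMap_le : ∀ {n : ℕ} (F : L.Functions n) (a b : Fin n → M),
    dist (funMap F a) (funMap F b) ≤ L.funLip F * ∑ k, dist (a k) (b k)
  relMap_mem : ∀ {n : ℕ} (R : L.Relations n) (a : Fin n → M), relMap R a ∈ Set.Icc (0 : ℝ) 1
  dist_relMap_le : ∀ {n : ℕ} (R : L.Relations n) (a b : Fin n → M),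
    dist (relMap R a) (relMap R b) ≤ L.relLip R * ∑ k, dist (a k) (b k)

/-- A prestructure: a metric prestructure with a regular Borel probability charge. A structure is a
prestructure on a complete metric space. -/
structure Prestructure.{u, v, w} (L : LipschitzLanguage.{u, v}) (M : Type w) [PseudoMetricSpace M]
    extends MetricPrestructure L M where
  charge : BorelCharge M
  isRegular : charge.IsRegular

/-! ### Formulas of affine integration logic and their values -/

/-- `Formula L n` is the type of formulas whose free variables are among `x₀, …, xₙ₋₁`.
A quantifier binds the last variable of a formula in `n + 1` variables. -/
inductive Formula.{u, v} (L : LipschitzLanguage.{u, v}) : ℕ → Type (max u v)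
  | one {n : ℕ} : Formula L n
  | rel {n k : ℕ} (R : L.Relations k) (t : Fin k → L.toLanguage.Term (Fin n)) : Formula L n
  | dist {n : ℕ} (t₁ t₂ : L.toLanguage.Term (Fin n)) : Formula L n
  | add {n : ℕ} (φ ψ : Formula L n) : Formula L n
  | smul {n : ℕ} (r : ℝ) (φ : Formula L n) : Formula L n
  | inf {n : ℕ} (φ : Formula L (n + 1)) : Formula L n
  | sup {n : ℕ} (φ : Formula L (n + 1)) : Formula L n
  | int {n : ℕ} (φ : Formula L (n + 1)) : Formula L n

section Semantics

universe u v w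

variable {L : LipschitzLanguage.{u, v}} {M : Type w} [PseudoMetricSpace M]

/-- The value of a term. -/
def MetricPrestructure.termValue (S : MetricPrestructure L M) {n : ℕ} (a : Fin n → M) :
    L.toLanguage.Term (Fin n) → M
  | .var k => a k
  | .func F t => S.funMap F fun j => S.termValue a (t j)

/-- The value `φ^M(a)` of a formula. -/
noncomputable def Prestructure.value (S : Prestructure L M) :
    {n : ℕ} → Formula L n → (Fin n → M) → ℝ
  | _, .one, _ => 1
  | _, .rel R t, a => S.relMap R fun j => S.termValue a (t j)
  | _, .dist t₁ t₂, a => dist (S.termValue a t₁) (S.termValue a t₂)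
  | _, .add φ ψ, a => S.value φ a + S.value ψ a
  | _, .smul r φ, a => r * S.value φ a
  | _, .inf φ, a => ⨅ b : M, S.value φ (Fin.snoc a b)
  | _, .sup φ, a => ⨆ b : M, S.value φ (Fin.snoc a b)
  | _, .int φ, a => S.charge.integral fun b => S.value φ (Fin.snoc a b)

/-- `f` preserves the values of all formulas. -/
def IsElementaryEmbedding {N : Type*} [PseudoMetricSpace N] (S : Prestructure L M)
    (T : Prestructure L N) (f : M → N) : Prop :=
  ∀ (n : ℕ) (φ : Formula L n) (a : Fin n → M), S.value φ a = T.value φ fun k => f (a k)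

end Semantics

/-! ### The ultramean -/

section Ultramean

universe u v w x

variable {L : LipschitzLanguage.{u, v}} {I : Type w} {M : I → Type x}
  [∀ i, PseudoMetricSpace (M i)]

theorem MetricPrestructure.abs_dist_le {N : Type*} [PseudoMetricSpace N]
    (S : MetricPrestructure L N) (a b : N) : |dist a b| ≤ 1 := by
  rw [abs_of_nonneg dist_nonneg]
  exact S.dist_le_one a b

theorem MetricPrestructure.abs_relMap_le {N : Type*} [PseudoMetricSpace N]
    (S : MetricPrestructure L N) {n : ℕ} (R : L.Relations n) (a : Fin n → N) :
    |S.relMap R a| ≤ 1 := by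
  rw [abs_of_nonneg (S.relMap_mem R a).1]
  exact (S.relMap_mem R a).2

/-- The product of the `M i`, to be equipped with the pseudometric `∫ ρᵢ(aᵢ, bᵢ) dP`. -/
def PreUltramean (_P : Ultracharge I) (_S : ∀ i, MetricPrestructure L (M i)) := ∀ i, M i

variable (P : Ultracharge I) (S : ∀ i, MetricPrestructure L (M i))

noncomputable instance : PseudoMetricSpace (PreUltramean P S) where
  dist a b := P.integral fun i => dist (a i) (b i)
  dist_self a := by simpa using P.integral_const 0
  dist_comm a b := by simp only [dist_comm]
  dist_triangle a b c := by
    have := P.integral_le_of_le (n := 1) (f := fun i => dist (a i) (c i))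
      (g := fun i => dist (a i) (b i)) (h := fun _ i => dist (b i) (c i)) (B := 1) (r := 1)
      (fun i => (S i).abs_dist_le _ _) (fun i => (S i).abs_dist_le _ _)
      (fun _ i => (S i).abs_dist_le _ _) zero_le_one
      (fun i => by simpa using dist_triangle (a i) (b i) (c i))
    simpa using this

/-- The ultramean: the quotient metric space of the product by `∫ ρᵢ(aᵢ, bᵢ) dP = 0`. -/
abbrev Ultramean := SeparationQuotient (PreUltramean P S)

namespace Ultramean

/-- The class `[aᵢ]` of a family. -/
noncomputable def mk (a : ∀ i, M i) : Ultramean P S := SeparationQuotient.mk (show PreUltramean P S from a)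

/-- A representative of an element of the ultramean. -/
noncomputable def rep (z : Ultramean P S) : ∀ i, M i := Function.surjInv
  (SeparationQuotient.surjective_mk (X := PreUltramean P S)) z

theorem mk_rep (z : Ultramean P S) : mk P S (rep P S z) = z :=
  Function.surjInv_eq (SeparationQuotient.surjective_mk (X := PreUltramean P S)) z

/-- The metric of the ultramean. -/
theorem dist_mk (a b : ∀ i, M i) :
    dist (mk P S a) (mk P S b) = P.integral fun i => dist (a i) (b i) := rfl

theorem dist_eq (y z : Ultramean P S) :
    dist y z = P.integral fun i => dist (rep P S y i) (rep P S z i) := by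
  rw [← dist_mk, mk_rep, mk_rep]

theorem integral_dist_rep (a : ∀ i, M i) :
    P.integral (fun i => dist (rep P S (mk P S a) i) (a i)) = 0 := by
  rw [← dist_mk, mk_rep, dist_self]

theorem dist_fun_le {n : ℕ} (F : L.Functions n) (a b : Fin n → ∀ i, M i) :
    P.integral (fun i => dist ((S i).funMap F fun k => a k i) ((S i).funMap F fun k => b k i)) ≤
      L.funLip F * ∑ k, P.integral fun i => dist (a k i) (b k i) := by
  have := P.integral_le_of_le (g := fun _ => 0) (h := fun k i => dist (a k i) (b k i))
    (B := 1) (fun i => (S i).abs_dist_le ((S i).funMap F fun k => a k i)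
      ((S i).funMap F fun k => b k i)) (fun _ => by simp) (fun _ i => (S i).abs_dist_le _ _)
      (L.funLip F).2 (fun i => by simpa using (S i).dist_funMap_le F _ _)
  rw [P.integral_const, zero_add] at this
  exact this

theorem dist_rel_le {n : ℕ} (R : L.Relations n) (a b : Fin n → ∀ i, M i) :
    dist (P.integral fun i => (S i).relMap R fun k => a k i)
        (P.integral fun i => (S i).relMap R fun k => b k i) ≤
      L.relLip R * ∑ k, P.integral fun i => dist (a k i) (b k i) := by
  have key : ∀ a b : Fin n → ∀ i, M i, P.integral (fun i => (S i).relMap R fun k => a k i) ≤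
      P.integral (fun i => (S i).relMap R fun k => b k i) +
        L.relLip R * ∑ k, P.integral fun i => dist (a k i) (b k i) := fun a b =>
    P.integral_le_of_le (h := fun k i => dist (a k i) (b k i)) (B := 1)
      (fun i => (S i).abs_relMap_le R _) (fun i => (S i).abs_relMap_le R _)
      (fun _ i => (S i).abs_dist_le _ _) (L.relLip R).2 (fun i => by
        have h := (S i).dist_relMap_le R (fun k => a k i) (fun k => b k i)
        rw [Real.dist_eq] at h
        have h' := (abs_le.1 h).2
        have e : ((L.relLip R).1 : ℝ) = (L.relLip R : ℝ) := rfl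
        linarith)
  rw [Real.dist_eq, abs_le]
  have h1 := key a b
  have h2 := key b a
  simp only [dist_comm] at h1 h2 ⊢
  constructor <;> linarith

/-- The interpretation of the function and relation symbols in the ultramean, through
representatives; by `funMap_mk` and `relMap_mk` below the choice is irrelevant. -/
noncomputable def metricPrestructure : MetricPrestructure L (Ultramean P S) where
  dist_le_one y z := by
    rw [dist_eq]
    exact (abs_le.1 (P.abs_integral_le fun i => (S i).abs_dist_le _ _)).2
  funMap F z := mk P S fun i => (S i).funMap F fun k => rep P S (z k) i
  relMap R z := P.integral fun i => (S i).relMap R fun k => rep P S (z k) i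
  dist_funMap_le F y z := by
    rw [dist_mk]
    simp only [dist_eq P S]
    exact dist_fun_le P S F _ _
  relMap_mem R z :=
    ⟨(P.integral_const 0).symm.le.trans (P.integral_mono (B := 1) (fun _ => by simp)
      (fun i => (S i).abs_relMap_le R _) fun i => ((S i).relMap_mem R _).1),
      (abs_le.1 (P.abs_integral_le fun i => (S i).abs_relMap_le R _)).2⟩
  dist_relMap_le R y z := by
    simp only [dist_eq P S]
    exact dist_rel_le P S R _ _

theorem funMap_mk {n : ℕ} (F : L.Functions n) (a : Fin n → ∀ i, M i) :
    (metricPrestructure P S).funMap F (fun k => mk P S (a k)) =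
      mk P S fun i => (S i).funMap F fun k => a k i := by
  refine eq_of_dist_eq_zero (le_antisymm ?_ dist_nonneg)
  have := dist_fun_le P S F (fun k => rep P S (mk P S (a k))) a
  simp only [integral_dist_rep, Finset.sum_const_zero, mul_zero] at this
  exact this

theorem relMap_mk {n : ℕ} (R : L.Relations n) (a : Fin n → ∀ i, M i) :
    (metricPrestructure P S).relMap R (fun k => mk P S (a k)) =
      P.integral fun i => (S i).relMap R fun k => a k i := by
  refine eq_of_dist_eq_zero (le_antisymm ?_ dist_nonneg)
  have := dist_rel_le P S R (fun k => rep P S (mk P S (a k))) a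
  simp only [integral_dist_rep, Finset.sum_const_zero, mul_zero] at this
  exact this

end Ultramean

/-- Families of functions `fᵢ : Mᵢ → ℝ` which are `lip`-Lipschitz and bounded by `bound`, with
`lip` and `bound` independent of `i`. -/
structure LipschitzFamily (M : I → Type x) [∀ i, PseudoMetricSpace (M i)] where
  toFun : ∀ i, M i → ℝ
  lip : ℝ≥0
  bound : ℝ
  lipschitzWith : ∀ i, LipschitzWith lip (toFun i)
  abs_le_bound : ∀ i y, |toFun i y| ≤ bound

/-- The function `[fᵢ]` on the ultramean, given by `[fᵢ]([xᵢ]) = ∫ fᵢ(xᵢ) dP`. -/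
noncomputable def LipschitzFamily.toUltramean (f : LipschitzFamily M) (z : Ultramean P S) : ℝ :=
  P.integral fun i => f.toFun i (Ultramean.rep P S z i)

theorem LipschitzFamily.toUltramean_mk (f : LipschitzFamily M) (a : ∀ i, M i) :
    f.toUltramean P S (Ultramean.mk P S a) = P.integral fun i => f.toFun i (a i) := by
  have key : ∀ a b : ∀ i, M i, P.integral (fun i => f.toFun i (a i)) ≤
      P.integral (fun i => f.toFun i (b i)) + f.lip * P.integral fun i => dist (a i) (b i) := by
    intro a b
    have := P.integral_le_of_le (n := 1) (h := fun _ i => dist (a i) (b i))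
      (fun i => f.abs_le_bound i (a i)) (fun i => f.abs_le_bound i (b i))
      (fun _ i => (S i).abs_dist_le _ _) f.lip.2 (fun i => by
        have h := (f.lipschitzWith i).dist_le_mul (a i) (b i)
        rw [Real.dist_eq] at h
        have h' := (abs_le.1 h).2
        have e : f.toFun i (a i) ≤ f.toFun i (b i) + f.lip * dist (a i) (b i) := by linarith
        simpa using e)
    simpa using this
  have h0 := Ultramean.integral_dist_rep P S a
  have h1 := key (Ultramean.rep P S (Ultramean.mk P S a)) a
  have h2 := key a (Ultramean.rep P S (Ultramean.mk P S a))
  simp only [dist_comm (a _)] at h2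
  rw [h0, mul_zero, add_zero] at h1 h2
  exact le_antisymm h1 h2

end Ultramean

section UltrameanCharge

universe u v w x

variable {L : LipschitzLanguage.{u, v}} {I : Type w} {M : I → Type x}
  [∀ i, PseudoMetricSpace (M i)] (P : Ultracharge I) (S : ∀ i, Prestructure L (M i))

/-- The underlying metric space of the ultramean of a family of prestructures. -/
abbrev UltrameanSpace := Ultramean P fun i => (S i).toMetricPrestructure

/-- `Φ` is a positive linear functional on the bounded continuous functions on the ultramean which
extends the functional `[fᵢ] ↦ ∫ (∫ fᵢ dμᵢ) dP`. -/
structure IsPositiveExtension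
    (Φ : BoundedContinuousFunction (UltrameanSpace P S) ℝ →ₗ[ℝ] ℝ) : Prop where
  nonneg : ∀ g : BoundedContinuousFunction (UltrameanSpace P S) ℝ, (∀ z, 0 ≤ g z) → 0 ≤ Φ g
  extends_family : ∀ (f : LipschitzFamily M) (g : BoundedContinuousFunction (UltrameanSpace P S) ℝ),
    (∀ z, g z = f.toUltramean P (fun i => (S i).toMetricPrestructure) z) →
      Φ g = P.integral fun i => (S i).charge.integral (f.toFun i)

/-- `μ` is a regular Borel charge on the ultramean which represents the functional
`[fᵢ] ↦ ∫ (∫ fᵢ dμᵢ) dP` on the space of all functions `[fᵢ]`. -/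
structure IsUltrameanCharge (μ : BorelCharge (UltrameanSpace P S)) : Prop where
  isRegular : μ.IsRegular
  integral_eq : ∀ f : LipschitzFamily M,
    μ.integral (f.toUltramean P fun i => (S i).toMetricPrestructure) =
      P.integral fun i => (S i).charge.integral (f.toFun i)

/-- The ultramean as a prestructure, equipped with such a charge. -/
noncomputable def ultrameanPrestructure (μ : BorelCharge (UltrameanSpace P S))
    (hμ : IsUltrameanCharge P S μ) : Prestructure L (UltrameanSpace P S) where
  toMetricPrestructure := Ultramean.metricPrestructure P fun i => (S i).toMetricPrestructure
  charge := μ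
  isRegular := hμ.isRegular

/-- The class `[aᵢ]` in the ultramean of a family of prestructures. -/
noncomputable def ultrameanClass (a : ∀ i, M i) : UltrameanSpace P S :=
  Ultramean.mk P (fun i => (S i).toMetricPrestructure) a

end UltrameanCharge

end AffineIntegration

open AffineIntegration

/-!
The ultramean theorem rests on three independent arguments.

*Existence of `Φ`.* The functional `[fᵢ] ↦ ∫ (∫ fᵢ dμᵢ) dP` lives on a subspace of the bounded
continuous functions that contains the constants. It is positive: choosing `xᵢ` with
`fᵢ(xᵢ) ≤ ∫ fᵢ dμᵢ + ε` gives `[fᵢ]([xᵢ]) ≤ ∫ (∫ fᵢ dμᵢ) dP + ε`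
(`LipschitzFamily.iteratedIntegral_nonneg`). Positivity also makes it well defined, and the
extension theorem of M. Riesz yields `Φ` (`exists_isPositiveExtension`).

*Representation of `Φ`.* This is Alexandroff's theorem for a normal space. Put `λ(F) = inf {Φ f | f
≥ 0, f ≥ 1 on F}` for closed `F` and let `μ(A)` be the supremum of `λ(F)` over the closed subsets
`F` of `A`. Urysohn's lemma shows that `λ`, hence `μ`, is supermodular
(`closedContent_supermodular`). Together with `μ(∅) = 0` and `μ(X) = 1` this implies that the sets
`A` with `μ(A) + μ(Aᶜ) = 1` form an algebra on which `μ` is additive; it contains the open sets, so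
`μ` is a Borel charge (`innerContent_add_compl`, `innerContent_union`). Regularity is built in, and
the lower sums of `g` are at most `Φ g`, because a step function can be replaced by one with
disjoint closed level sets, and `g` split accordingly by Urysohn functions
(`sum_mul_closedContent_le`). Applied to `g` and `-g`, this gives `∫ g dμ = Φ g`.

*Values of formulas.* Each formula has a bound and a Lipschitz constant valid in all prestructures
(`exists_value_bound_lipschitz`), so that `φ^{Mᵢ}(aᵢ, ·)` is a Lipschitz family. The mean theorem
`ultrameanPrestructure_value` then follows by induction on the formula. For infima and suprema,
almost extremal points are chosen in every `Mᵢ`, and for the integral quantifier the claim is the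
defining property of `μ`. The diagonal embedding is the case of constant families.
-/

namespace AffineIntegration

/-! ### Linearity of the integral with respect to a charge -/

namespace Charge

variable {X : Type*} {C : Set (Set X)} (μ : Charge C)

theorem mem_lowerSums_neg {f : X → ℝ} {r : ℝ} :
    r ∈ μ.lowerSums (fun x => -f x) ↔ -r ∈ μ.upperSums f := by
  constructor
  · rintro ⟨n, π, c, hπ, hc, rfl⟩
    exact ⟨n, π, fun k => -c k, hπ, fun x => by linarith [hc x], by simp⟩
  · rintro ⟨n, π, c, hπ, hc, hr⟩
    exact ⟨n, π, fun k => -c k, hπ, fun x => by linarith [hc x], by simp [← hr]⟩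

theorem lowerIntegral_neg (f : X → ℝ) :
    μ.lowerIntegral (fun x => -f x) = -μ.upperIntegral f := by
  have h : μ.lowerSums (fun x => -f x) = -μ.upperSums f := by
    ext r
    rw [mem_lowerSums_neg, Set.mem_neg]
  rw [lowerIntegral, upperIntegral, Real.sInf_def, h, neg_neg]

theorem upperIntegral_neg (f : X → ℝ) :
    μ.upperIntegral (fun x => -f x) = -μ.lowerIntegral f := by
  simpa using congrArg Neg.neg (μ.lowerIntegral_neg fun x => -f x).symm

theorem lowerIntegral_le_upperIntegral {f : X → ℝ} {B : ℝ} (hB : ∀ x, |f x| ≤ B) :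
    μ.lowerIntegral f ≤ μ.upperIntegral f :=
  csSup_le ⟨_, μ.const_mem_lowerSums fun x => (abs_le.1 (hB x)).1⟩ fun _ hr =>
    le_csInf ⟨_, μ.const_mem_upperSums fun x => (abs_le.1 (hB x)).2⟩ fun _ hs =>
      μ.lower_le_upper (fun _ => le_rfl) hr hs

theorem integral_add {f g : X → ℝ} (hf : μ.IsIntegrable f) (hg : μ.IsIntegrable g) :
    μ.integral (fun x => f x + g x) = μ.integral f + μ.integral g := by
  obtain ⟨⟨A, hA⟩, hf⟩ := hf
  obtain ⟨⟨B, hB⟩, hg⟩ := hg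
  have h1 := μ.upperIntegral_add_le hA hB
  have h2 := μ.upperIntegral_add_le (f := fun x => -f x) (g := fun x => -g x)
    (fun x => (abs_neg _).le.trans (hA x)) (fun x => (abs_neg _).le.trans (hB x))
  have e : (fun x => -f x + -g x) = fun x => -(f x + g x) := funext fun x => by ring
  rw [e, upperIntegral_neg, upperIntegral_neg, upperIntegral_neg] at h2
  have h3 := μ.lowerIntegral_le_upperIntegral (f := fun x => f x + g x) (B := A + B) fun x =>
    (abs_add_le _ _).trans (add_le_add (hA x) (hB x))
  unfold integral
  linarith

theorem integral_neg {f : X → ℝ} (hf : μ.IsIntegrable f) :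
    μ.integral (fun x => -f x) = -μ.integral f := by
  rw [integral, lowerIntegral_neg, integral, hf.2]

theorem integral_const_mul {f : X → ℝ} (hf : μ.IsIntegrable f) (r : ℝ) :
    μ.integral (fun x => r * f x) = r * μ.integral f := by
  obtain ⟨⟨B, hB⟩, -⟩ := id hf
  have key : ∀ r : ℝ, 0 ≤ r → μ.IsIntegrable (fun x => r * f x) ∧
      μ.integral (fun x => r * f x) = r * μ.integral f := by
    intro r hr
    have hb : ∀ x, |r * f x| ≤ r * B := fun x => by
      rw [abs_mul, abs_of_nonneg hr]
      exact mul_le_mul_of_nonneg_left (hB x) hr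
    have h1 := μ.upperIntegral_mul_le hB hr
    have h2 := μ.upperIntegral_mul_le (f := fun x => -f x)
      (fun x => (abs_neg _).le.trans (hB x)) hr
    simp only [mul_neg] at h2
    rw [upperIntegral_neg, upperIntegral_neg] at h2
    have h3 := μ.lowerIntegral_le_upperIntegral hb
    have h4 := hf.2
    rw [← h4] at h1
    refine ⟨⟨⟨_, hb⟩, ?_⟩, ?_⟩ <;> unfold integral at * <;> linarith
  rcases le_total 0 r with hr | hr
  · exact (key r hr).2
  · obtain ⟨h1, h2⟩ := key (-r) (by linarith)
    have h3 := μ.integral_neg h1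
    rw [h2] at h3
    simpa only [neg_mul, neg_neg] using h3

theorem integral_le_integral_add_const {f g : X → ℝ} {B c : ℝ} (hf : ∀ x, |f x| ≤ B)
    (hg : ∀ x, |g x| ≤ B) (h : ∀ x, f x ≤ g x + c) : μ.integral f ≤ μ.integral g + c := by
  refine csSup_le ⟨_, μ.const_mem_lowerSums fun x => (abs_le.1 (hf x)).1⟩ ?_
  rintro r ⟨n, π, d, hπ, hd, rfl⟩
  have h1 := μ.mem_lowerSums (f := g) π (fun k => d k - c) hπ fun x => by
    linarith [hd x, h x]
  have h2 := le_csSup (μ.bddAbove_lowerSums fun x => (abs_le.1 (hg x)).2) h1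
  simp only [sub_mul, Finset.sum_sub_distrib, ← Finset.mul_sum, μ.sum_real hπ, mul_one] at h2
  unfold integral lowerIntegral
  linarith

/-- A probability charge lives on a nonempty space, since `∅` has charge `0`. -/
theorem nonempty (μ : Charge C) : Nonempty X := by
  by_contra h
  rw [not_nonempty_iff] at h
  have h1 := μ.real_univ
  rw [Set.univ_eq_empty_iff.2 h] at h1
  simp [real] at h1

end Charge

/-! ### Representation of positive functionals on a normal space by regular Borel charges -/

section Representation

open BoundedContinuousFunction

variable {X : Type*} [TopologicalSpace X]

/-- The functional `Φ` on bounded continuous functions is positive and normalized. -/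
structure IsNormalizedPositive (Φ : (X →ᵇ ℝ) →ₗ[ℝ] ℝ) : Prop where
  nonneg : ∀ g : X →ᵇ ℝ, (∀ x, 0 ≤ g x) → 0 ≤ Φ g
  map_one : Φ 1 = 1

/-- The measure of a closed set `F` determined by `Φ`: the infimum of `Φ f` over all continuous
`f` with `f ≥ 0` and `f ≥ 1` on `F`. -/
noncomputable def closedContent (Φ : (X →ᵇ ℝ) →ₗ[ℝ] ℝ) (F : Set X) : ℝ :=
  sInf {r | ∃ f : X →ᵇ ℝ, (∀ x, 0 ≤ f x) ∧ (∀ x ∈ F, 1 ≤ f x) ∧ r = Φ f}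

/-- The supremum of the measures of the closed subsets of a set. -/
noncomputable def innerContent (Φ : (X →ᵇ ℝ) →ₗ[ℝ] ℝ) (A : Set X) : ℝ :=
  sSup {r | ∃ F, IsClosed F ∧ F ⊆ A ∧ r = closedContent Φ F}

theorem borelAlgebra_of_isClosed {F : Set X} (hF : IsClosed F) : F ∈ borelAlgebra X :=
  compl_compl F ▸ generateSetAlgebra.compl _ (generateSetAlgebra.base _ hF.isOpen_compl)

variable {Φ : (X →ᵇ ℝ) →ₗ[ℝ] ℝ}

theorem le_closedContent {F : Set X} {r : ℝ}
    (h : ∀ f : X →ᵇ ℝ, (∀ x, 0 ≤ f x) → (∀ x ∈ F, 1 ≤ f x) → r ≤ Φ f) :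
    r ≤ closedContent Φ F := by
  refine le_csInf ⟨Φ 1, 1, fun _ => zero_le_one, fun _ _ => le_rfl, rfl⟩ ?_
  rintro _ ⟨f, hf, h1, rfl⟩
  exact h f hf h1

theorem exists_map_lt {F : Set X} {ε : ℝ} (hε : 0 < ε) : ∃ f : X →ᵇ ℝ, (∀ x, 0 ≤ f x) ∧
    (∀ x ∈ F, 1 ≤ f x) ∧ Φ f < closedContent Φ F + ε := by
  by_contra! h
  have := le_closedContent h
  linarith

theorem innerContent_le {A : Set X} {r : ℝ}
    (h : ∀ F, IsClosed F → F ⊆ A → closedContent Φ F ≤ r) : innerContent Φ A ≤ r := by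
  refine csSup_le ⟨_, ∅, isClosed_empty, empty_subset A, rfl⟩ ?_
  rintro _ ⟨F, hF, hFA, rfl⟩
  exact h F hF hFA

theorem exists_closed_gt (A : Set X) {ε : ℝ} (hε : 0 < ε) :
    ∃ F, IsClosed F ∧ F ⊆ A ∧ innerContent Φ A < closedContent Φ F + ε := by
  by_contra! h
  have := innerContent_le (Φ := Φ) (A := A) (r := innerContent Φ A - ε) fun F hF hFA => by
    linarith [h F hF hFA]
  linarith


namespace IsNormalizedPositive

theorem mono (hΦ : IsNormalizedPositive Φ) {f g : X →ᵇ ℝ} (h : ∀ x, f x ≤ g x) : Φ f ≤ Φ g := by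
  have := hΦ.nonneg (g - f) fun x => by simpa using h x
  rw [map_sub] at this
  linarith

theorem map_const (hΦ : IsNormalizedPositive Φ) (c : ℝ) : Φ (const X c) = c := by
  have : const X c = c • (1 : X →ᵇ ℝ) := by ext; simp
  rw [this, map_smul, hΦ.map_one, smul_eq_mul, mul_one]

theorem bddBelow_closedContent (hΦ : IsNormalizedPositive Φ) (F : Set X) : BddBelow
    {r | ∃ f : X →ᵇ ℝ, (∀ x, 0 ≤ f x) ∧ (∀ x ∈ F, 1 ≤ f x) ∧ r = Φ f} :=
  ⟨0, by rintro _ ⟨f, hf, -, rfl⟩; exact hΦ.nonneg f hf⟩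

theorem closedContent_le (hΦ : IsNormalizedPositive Φ)
    {F : Set X} (f : X →ᵇ ℝ) (hf : ∀ x, 0 ≤ f x) (h1 : ∀ x ∈ F, 1 ≤ f x) :
    closedContent Φ F ≤ Φ f :=
  csInf_le (hΦ.bddBelow_closedContent F) ⟨f, hf, h1, rfl⟩

theorem closedContent_nonneg (hΦ : IsNormalizedPositive Φ) (F : Set X) : 0 ≤ closedContent Φ F :=
  le_closedContent fun f hf _ => hΦ.nonneg f hf

theorem closedContent_le_one (hΦ : IsNormalizedPositive Φ) (F : Set X) : closedContent Φ F ≤ 1 :=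
  hΦ.map_one ▸ hΦ.closedContent_le 1 (fun _ => zero_le_one) fun _ _ => le_rfl

theorem closedContent_mono (hΦ : IsNormalizedPositive Φ)
    {F H : Set X} (h : F ⊆ H) : closedContent Φ F ≤ closedContent Φ H :=
  le_closedContent fun f hf h1 => hΦ.closedContent_le f hf fun x hx => h1 x (h hx)

theorem closedContent_empty (hΦ : IsNormalizedPositive Φ) : closedContent Φ ∅ = 0 :=
  le_antisymm (by simpa using hΦ.closedContent_le (F := ∅) 0 (fun _ => le_rfl) (by simp))
    (hΦ.closedContent_nonneg _)

theorem closedContent_univ (hΦ : IsNormalizedPositive Φ) : closedContent Φ univ = 1 :=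
  le_antisymm (hΦ.closedContent_le_one _) (le_closedContent fun _ _ h1 =>
    hΦ.map_one ▸ hΦ.mono fun x => h1 x (mem_univ x))

/-- If `g ≥ 1` on `E ∩ F` and `h ≥ 1` on `E ∪ F`, then a Urysohn function `u` separating the parts
of `E` and `F` where `g` is small gives the functions `max (u h) g'` and `max ((1 - u) h) g'` with
`g' = min (g + ε) h`. They dominate the indicators of `E` and `F`, and their sum is at most
`g + h + ε`. -/
theorem closedContent_supermodular (hΦ : IsNormalizedPositive Φ)
    [NormalSpace X] {E F : Set X} (hE : IsClosed E)
    (hF : IsClosed F) : closedContent Φ E + closedContent Φ F ≤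
      closedContent Φ (E ∩ F) + closedContent Φ (E ∪ F) := by
  refine le_of_forall_pos_le_add fun ε hε => ?_
  obtain ⟨g, g0, g1, hg⟩ := exists_map_lt (Φ := Φ) (F := E ∩ F) (by positivity : 0 < ε / 3)
  obtain ⟨h, h0, h1, hh⟩ := exists_map_lt (Φ := Φ) (F := E ∪ F) (by positivity : 0 < ε / 3)
  let V : Set X := {x | g x ≤ 1 - ε / 3}
  have hV : IsClosed V := isClosed_le g.continuous continuous_const
  have hd : Disjoint (F ∩ V) (E ∩ V) := Set.disjoint_left.2 fun x hx hx' => by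
    have := g1 x ⟨hx'.1, hx.1⟩
    have h2 : g x ≤ 1 - ε / 3 := hx.2
    linarith
  obtain ⟨u, uF, uE, hu⟩ := exists_bounded_zero_one_of_closed (hF.inter hV) (hE.inter hV) hd
  let g' : X →ᵇ ℝ := (g + const X (ε / 3)) ⊓ h
  have hg' : ∀ x, g' x = min (g x + ε / 3) (h x) := fun x => rfl
  have b1 := hΦ.closedContent_le (F := E) ((u * h) ⊔ g')
    (fun x => le_max_of_le_left (mul_nonneg (hu x).1 (h0 x))) (fun x hx => by
      change 1 ≤ max (u x * h x) (g' x)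
      have := h1 x (Or.inl hx)
      by_cases hxV : x ∈ V
      · have e : u x = 1 := uE ⟨hx, hxV⟩
        rw [e, one_mul]
        exact le_max_of_le_left this
      · have : 1 - ε / 3 < g x := not_le.1 hxV
        exact le_max_of_le_right (by rw [hg']; exact le_min (by linarith) (by assumption)))
  have b2 := hΦ.closedContent_le (F := F) (((1 - u) * h) ⊔ g')
    (fun x => le_max_of_le_left (mul_nonneg (sub_nonneg.2 (hu x).2) (h0 x))) (fun x hx => by
      change 1 ≤ max ((1 - u x) * h x) (g' x)
      have := h1 x (Or.inr hx)
      by_cases hxV : x ∈ V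
      · have e : u x = 0 := uF ⟨hx, hxV⟩
        rw [e, sub_zero, one_mul]
        exact le_max_of_le_left this
      · have : 1 - ε / 3 < g x := not_le.1 hxV
        exact le_max_of_le_right (by rw [hg']; exact le_min (by linarith) (by assumption)))
  have b3 : Φ (((u * h) ⊔ g') + (((1 - u) * h) ⊔ g')) ≤ Φ (h + (g + const X (ε / 3))) := by
    refine hΦ.mono fun x => ?_
    change max (u x * h x) (g' x) + max ((1 - u x) * h x) (g' x) ≤ h x + (g x + ε / 3)
    have i1 : g' x ≤ g x + ε / 3 := (hg' x).le.trans (min_le_left _ _)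
    have i2 : g' x ≤ h x := (hg' x).le.trans (min_le_right _ _)
    have i3 := mul_nonneg (hu x).1 (h0 x)
    have i4 := mul_nonneg (sub_nonneg.2 (hu x).2) (h0 x)
    have i5 := g0 x
    rcases max_cases (u x * h x) (g' x) with ⟨e1, -⟩ | ⟨e1, -⟩ <;>
      rcases max_cases ((1 - u x) * h x) (g' x) with ⟨e2, -⟩ | ⟨e2, -⟩ <;>
      rw [e1, e2] <;> nlinarith
  rw [map_add, map_add, map_add, hΦ.map_const] at b3
  linarith

theorem bddAbove_innerContent (hΦ : IsNormalizedPositive Φ)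
    (A : Set X) : BddAbove {r | ∃ F, IsClosed F ∧ F ⊆ A ∧ r = closedContent Φ F} :=
  ⟨1, by rintro _ ⟨F, -, -, rfl⟩; exact hΦ.closedContent_le_one F⟩

theorem closedContent_le_innerContent (hΦ : IsNormalizedPositive Φ)
    {F A : Set X} (hF : IsClosed F) (h : F ⊆ A) :
    closedContent Φ F ≤ innerContent Φ A :=
  le_csSup (hΦ.bddAbove_innerContent A) ⟨F, hF, h, rfl⟩

theorem innerContent_of_isClosed (hΦ : IsNormalizedPositive Φ) {F : Set X} (hF : IsClosed F) :
    innerContent Φ F = closedContent Φ F :=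
  le_antisymm (innerContent_le fun _ _ h => hΦ.closedContent_mono h)
    (hΦ.closedContent_le_innerContent hF Subset.rfl)

theorem innerContent_empty (hΦ : IsNormalizedPositive Φ) : innerContent Φ ∅ = 0 := by
  rw [hΦ.innerContent_of_isClosed isClosed_empty, hΦ.closedContent_empty]

theorem innerContent_univ (hΦ : IsNormalizedPositive Φ) : innerContent Φ univ = 1 := by
  rw [hΦ.innerContent_of_isClosed isClosed_univ, hΦ.closedContent_univ]

theorem innerContent_nonneg (hΦ : IsNormalizedPositive Φ) (A : Set X) : 0 ≤ innerContent Φ A :=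
  (hΦ.closedContent_nonneg ∅).trans
    (hΦ.closedContent_le_innerContent isClosed_empty (empty_subset A))

theorem innerContent_supermodular (hΦ : IsNormalizedPositive Φ) [NormalSpace X] (A B : Set X) :
    innerContent Φ A + innerContent Φ B ≤ innerContent Φ (A ∩ B) + innerContent Φ (A ∪ B) := by
  refine le_of_forall_pos_le_add fun ε hε => ?_
  obtain ⟨E, hE, hEA, h1⟩ := exists_closed_gt (Φ := Φ) A (half_pos hε)
  obtain ⟨F, hF, hFB, h2⟩ := exists_closed_gt (Φ := Φ) B (half_pos hε)
  have h3 := hΦ.closedContent_supermodular hE hF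
  have h4 := hΦ.closedContent_le_innerContent (hE.inter hF) (inter_subset_inter hEA hFB)
  have h5 := hΦ.closedContent_le_innerContent (hE.union hF) (union_subset_union hEA hFB)
  linarith

theorem innerContent_add_compl_le (hΦ : IsNormalizedPositive Φ) [NormalSpace X] (A : Set X) :
    innerContent Φ A + innerContent Φ Aᶜ ≤ 1 := by
  have := hΦ.innerContent_supermodular A Aᶜ
  rwa [inter_compl_self, union_compl_self, hΦ.innerContent_empty, hΦ.innerContent_univ,
    zero_add] at this

theorem innerContent_add_compl_of_isOpen (hΦ : IsNormalizedPositive Φ) {U : Set X} (hU : IsOpen U) :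
    1 ≤ innerContent Φ U + innerContent Φ Uᶜ := by
  refine le_of_forall_pos_le_add fun ε hε => ?_
  rw [hΦ.innerContent_of_isClosed hU.isClosed_compl]
  obtain ⟨f, f0, f1, hf⟩ := exists_map_lt (Φ := Φ) (F := Uᶜ) (half_pos hε)
  let H : Set X := {x | f x ≤ 1 - ε / 2}
  have hH : IsClosed H := isClosed_le f.continuous continuous_const
  have hHU : H ⊆ U := fun x hx => by
    by_contra hxU
    have := f1 x hxU
    have hx' : f x ≤ 1 - ε / 2 := hx
    linarith
  have h1 := hΦ.closedContent_le_innerContent hH hHU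
  -- Functions dominating the indicators of `H` and of the complement of `U` together cover `X`,
  -- up to an error of `ε / 2`.
  have h2 : 1 - ε / 2 - Φ f ≤ closedContent Φ H := by
    refine le_closedContent fun g g0 g1 => ?_
    have := hΦ.mono (f := 1) (g := f + g + const X (ε / 2)) fun x => by
      change 1 ≤ f x + g x + ε / 2
      by_cases hx : x ∈ H
      · linarith [g1 x hx, f0 x]
      · have : 1 - ε / 2 < f x := not_le.1 hx
        linarith [g0 x]
    rw [map_add, map_add, hΦ.map_const, hΦ.map_one] at this
    linarith
  linarith

/-- The sets whose inner content and that of the complement add up to `1` form an algebra: for the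
union of `A` and `B`, add the supermodular inequalities for `A, B` and for their complements. -/
theorem innerContent_add_compl (hΦ : IsNormalizedPositive Φ)
    [NormalSpace X] {A : Set X} (hA : A ∈ borelAlgebra X) :
    innerContent Φ A + innerContent Φ Aᶜ = 1 := by
  induction hA with
  | base U hU =>
    exact le_antisymm (hΦ.innerContent_add_compl_le U) (hΦ.innerContent_add_compl_of_isOpen hU)
  | empty => rw [compl_empty, hΦ.innerContent_empty, hΦ.innerContent_univ, zero_add]
  | compl A _ ih => rwa [compl_compl, add_comm]
  | union A B _ _ ihA ihB =>
    have h1 := hΦ.innerContent_supermodular A B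
    have h2 := hΦ.innerContent_supermodular Aᶜ Bᶜ
    have h3 := hΦ.innerContent_add_compl_le (A ∪ B)
    have h4 := hΦ.innerContent_add_compl_le (A ∩ B)
    rw [compl_union] at h3 ⊢
    rw [compl_inter] at h4
    linarith

theorem innerContent_union (hΦ : IsNormalizedPositive Φ)
    [NormalSpace X] {A B : Set X} (hA : A ∈ borelAlgebra X)
    (hB : B ∈ borelAlgebra X) (hd : Disjoint A B) :
    innerContent Φ (A ∪ B) = innerContent Φ A + innerContent Φ B := by
  have h1 := hΦ.innerContent_supermodular A B
  have h2 := hΦ.innerContent_supermodular Aᶜ Bᶜ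
  have h3 := hΦ.innerContent_add_compl (generateSetAlgebra.union _ _ hA hB)
  rw [hd.inter_eq, hΦ.innerContent_empty] at h1
  rw [← compl_inter, hd.inter_eq, compl_empty, hΦ.innerContent_univ, ← compl_union] at h2
  linarith [hΦ.innerContent_add_compl hA, hΦ.innerContent_add_compl hB]

/-- The regular Borel charge representing `Φ`. -/
noncomputable def borelCharge (hΦ : IsNormalizedPositive Φ) [NormalSpace X] : BorelCharge X where
  isSetAlgebra := isSetAlgebra_generateSetAlgebra
  content := IsSetRing.addContent_of_union
    (fun A => (⟨innerContent Φ A, hΦ.innerContent_nonneg A⟩ : ℝ≥0))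
    isSetAlgebra_generateSetAlgebra.isSetRing (NNReal.eq hΦ.innerContent_empty)
    fun hs ht hd => NNReal.eq (hΦ.innerContent_union hs ht hd)
  content_univ := NNReal.eq hΦ.innerContent_univ

theorem borelCharge_real (hΦ : IsNormalizedPositive Φ) [NormalSpace X] (A : Set X) :
    hΦ.borelCharge.real A = innerContent Φ A := rfl

theorem borelCharge_isRegular (hΦ : IsNormalizedPositive Φ)
    [NormalSpace X] : hΦ.borelCharge.IsRegular := by
  intro A hA
  have hsub : ∀ F B : Set X, IsClosed F → F ⊆ B → innerContent Φ F ≤ innerContent Φ B :=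
    fun F B hF h => (hΦ.innerContent_of_isClosed hF).le.trans
      (hΦ.closedContent_le_innerContent hF h)
  refine ⟨⟨?_, fun r hr => ?_⟩, ⟨?_, fun r hr => ?_⟩⟩
  · rintro _ ⟨F, -, hFA, hF, rfl⟩
    exact hsub F A hF hFA
  · refine innerContent_le fun F hF hFA => ?_
    rw [← hΦ.innerContent_of_isClosed hF]
    exact hr ⟨F, borelAlgebra_of_isClosed hF, hFA, hF, rfl⟩
  · rintro _ ⟨G, hG, hAG, hGo, rfl⟩
    have h1 := hsub Gᶜ Aᶜ hGo.isClosed_compl (compl_subset_compl.2 hAG)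
    have h2 := hΦ.innerContent_add_compl hA
    have h3 := hΦ.innerContent_add_compl hG
    rw [borelCharge_real, borelCharge_real]
    linarith
  · have h2 := hΦ.innerContent_add_compl hA
    have : innerContent Φ Aᶜ ≤ 1 - r := innerContent_le fun F hF hFA => by
      have hG : Fᶜ ∈ borelAlgebra X := generateSetAlgebra.base _ hF.isOpen_compl
      have h3 : r ≤ innerContent Φ Fᶜ :=
        hr ⟨Fᶜ, hG, subset_compl_comm.1 hFA, hF.isOpen_compl, rfl⟩
      have h4 := hΦ.innerContent_add_compl hG
      rw [compl_compl, hΦ.innerContent_of_isClosed hF] at h4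
      linarith
    rw [borelCharge_real]
    linarith

theorem mul_closedContent_le (hΦ : IsNormalizedPositive Φ)
    {F : Set X} {c : ℝ} (hc : 0 ≤ c) {g : X →ᵇ ℝ} (g0 : ∀ x, 0 ≤ g x)
    (hg : ∀ x ∈ F, c ≤ g x) : c * closedContent Φ F ≤ Φ g := by
  rcases hc.eq_or_lt with rfl | hc
  · simpa using hΦ.nonneg g g0
  · have := hΦ.closedContent_le (F := F) (c⁻¹ • g)
      (fun x => mul_nonneg (inv_nonneg.2 hc.le) (g0 x)) fun x hx => by
        change 1 ≤ c⁻¹ * g x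
        rw [inv_mul_eq_div, le_div_iff₀ hc, one_mul]
        exact hg x hx
    rwa [map_smul, smul_eq_mul, inv_mul_eq_div, le_div_iff₀ hc, mul_comm] at this

/-- A function dominating a step function with disjoint closed level sets is split by a Urysohn
function into a part dominating the first step and a part dominating the others. -/
theorem sum_mul_closedContent_le (hΦ : IsNormalizedPositive Φ)
    [NormalSpace X] {κ : Type*} (s : Finset κ) {F : κ → Set X}
    (hF : ∀ k, IsClosed (F k)) (hd : Pairwise fun k l => Disjoint (F k) (F l)) {c : κ → ℝ}
    (hc : ∀ k, 0 ≤ c k) (g : X →ᵇ ℝ) (g0 : ∀ x, 0 ≤ g x)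
    (hg : ∀ k ∈ s, ∀ x ∈ F k, c k ≤ g x) :
    ∑ k ∈ s, c k * closedContent Φ (F k) ≤ Φ g := by
  classical
  induction s using Finset.induction_on generalizing g with
  | empty => simpa using hΦ.nonneg g g0
  | insert k s hk ih =>
    have hd' : Disjoint (F k) (⋃ l ∈ s, F l) := by
      rw [Set.disjoint_iUnion₂_right]
      exact fun l hl => hd fun e => hk (e ▸ hl)
    obtain ⟨u, u0, u1, hu⟩ := exists_bounded_zero_one_of_closed (hF k)
      (s.finite_toSet.isClosed_biUnion fun l _ => hF l) hd'
    have h1 := hΦ.mul_closedContent_le (F := F k) (hc k) (g := (1 - u) * g)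
      (fun x => mul_nonneg (sub_nonneg.2 (hu x).2) (g0 x)) fun x hx => by
        have e : u x = 0 := u0 hx
        change c k ≤ (1 - u x) * g x
        rw [e, sub_zero, one_mul]
        exact hg k (Finset.mem_insert_self k s) x hx
    have h2 := ih (u * g) (fun x => mul_nonneg (hu x).1 (g0 x)) fun l hl x hx => by
      have e : u x = 1 := u1 (mem_biUnion (Finset.mem_coe.2 hl) hx)
      change c l ≤ u x * g x
      rw [e, one_mul]
      exact hg l (Finset.mem_insert_of_mem hl) x hx
    have e : g = (1 - u) * g + u * g := by ring
    rw [Finset.sum_insert hk, e, map_add]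
    exact add_le_add h1 h2

theorem lowerSums_le_of_nonneg (hΦ : IsNormalizedPositive Φ)
    [NormalSpace X] (g : X →ᵇ ℝ) (g0 : ∀ x, 0 ≤ g x) {r : ℝ}
    (hr : r ∈ hΦ.borelCharge.lowerSums g) : r ≤ Φ g := by
  obtain ⟨n, π, c, hπ, hc, rfl⟩ := hr
  refine le_of_forall_pos_le_add fun ε hε => ?_
  let d : Fin n → ℝ := fun k => max (c k) 0
  have hd0 : ∀ k, 0 ≤ d k := fun k => le_max_right _ _
  have hD : 0 ≤ ∑ k, d k := Finset.sum_nonneg fun k _ => hd0 k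
  let δ : ℝ := ε / (∑ k, d k + 1)
  have hδ : 0 < δ := by positivity
  have hδε : (∑ k, d k) * δ ≤ ε := by
    rw [mul_div_assoc', div_le_iff₀ (by positivity)]
    nlinarith
  -- The level sets are shrunk to closed ones, which costs at most `δ * ∑ d ≤ ε`.
  choose F hF hFA hlt using fun k => exists_closed_gt (Φ := Φ) (π ⁻¹' {k}) hδ
  have hdis : Pairwise fun k l => Disjoint (F k) (F l) := fun k l hkl =>
    Set.disjoint_left.2 fun x hx hx' => hkl ((hFA k hx).symm.trans (hFA l hx'))
  have h1 := hΦ.sum_mul_closedContent_le Finset.univ hF hdis hd0 g g0 fun k _ x hx => by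
    have e : π x = k := hFA k hx
    exact max_le (e ▸ hc x) (g0 x)
  calc ∑ k, c k * hΦ.borelCharge.real (π ⁻¹' {k})
      ≤ ∑ k, (d k * closedContent Φ (F k) + d k * δ) := Finset.sum_le_sum fun k _ => by
        rw [borelCharge_real, ← mul_add]
        exact mul_le_mul (le_max_left _ _) (hlt k).le (hΦ.innerContent_nonneg _) (hd0 k)
    _ = ∑ k, d k * closedContent Φ (F k) + (∑ k, d k) * δ := by
        rw [Finset.sum_add_distrib, Finset.sum_mul]
    _ ≤ Φ g + ε := add_le_add h1 hδε

theorem borelCharge_lowerIntegral_le (hΦ : IsNormalizedPositive Φ) [NormalSpace X] (g : X →ᵇ ℝ) :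
    hΦ.borelCharge.lowerIntegral g ≤ Φ g := by
  have hb : ∀ x, |g x| ≤ ‖g‖ := fun x => g.norm_coe_le_norm x
  refine csSup_le ⟨_, hΦ.borelCharge.const_mem_lowerSums fun x => (abs_le.1 (hb x)).1⟩ ?_
  rintro r ⟨n, π, c, hπ, hc, rfl⟩
  have h1 := hΦ.lowerSums_le_of_nonneg (g + const X ‖g‖)
    (fun x => by
      change 0 ≤ g x + ‖g‖
      linarith [(abs_le.1 (hb x)).1])
    (hΦ.borelCharge.mem_lowerSums π (fun k => c k + ‖g‖) hπ fun x => by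
      change _ ≤ g x + ‖g‖
      linarith [hc x])
  rw [map_add, hΦ.map_const] at h1
  simp only [add_mul, Finset.sum_add_distrib, ← Finset.mul_sum, hΦ.borelCharge.sum_real hπ,
    mul_one] at h1
  linarith

theorem borelCharge_integral (hΦ : IsNormalizedPositive Φ)
    [NormalSpace X] (g : X →ᵇ ℝ) : hΦ.borelCharge.integral g = Φ g := by
  have h1 := hΦ.borelCharge_lowerIntegral_le g
  have h2 := hΦ.borelCharge_lowerIntegral_le (-g)
  have e := (hΦ.borelCharge.isIntegrable g.continuous fun x => g.norm_coe_le_norm x).2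
  have h3 := hΦ.borelCharge.lowerIntegral_neg g
  rw [map_neg, show ⇑(-g) = fun x => -g x from rfl, h3, ← e] at h2
  unfold Charge.integral
  linarith

end IsNormalizedPositive

end Representation

/-! ### Positive extensions of the integral of Lipschitz families -/

section PositiveExtension

universe u v w x

variable {L : LipschitzLanguage.{u, v}} {I : Type w} {M : I → Type x}
  [∀ i, PseudoMetricSpace (M i)]

namespace LipschitzFamily

/-- The family of constant functions with value `c`. -/
def const (M : I → Type x) [∀ i, PseudoMetricSpace (M i)] (c : ℝ) : LipschitzFamily M where
  toFun _ _ := c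
  lip := 0
  bound := |c|
  lipschitzWith _ := LipschitzWith.const c
  abs_le_bound _ _ := le_rfl

/-- The pointwise sum of two families. -/
def add (f g : LipschitzFamily M) : LipschitzFamily M where
  toFun i y := f.toFun i y + g.toFun i y
  lip := f.lip + g.lip
  bound := f.bound + g.bound
  lipschitzWith i := (f.lipschitzWith i).add (g.lipschitzWith i)
  abs_le_bound i y := (abs_add_le _ _).trans (add_le_add (f.abs_le_bound i y) (g.abs_le_bound i y))

/-- The multiple of a family by a real scalar. -/
def smul (r : ℝ) (f : LipschitzFamily M) : LipschitzFamily M where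
  toFun i y := r * f.toFun i y
  lip := ‖r‖₊ * f.lip
  bound := |r| * f.bound
  lipschitzWith i := (lipschitzWith_smul r).comp (f.lipschitzWith i)
  abs_le_bound i y := by
    rw [abs_mul]
    exact mul_le_mul_of_nonneg_left (f.abs_le_bound i y) (abs_nonneg r)

section toUltramean

variable (P : Ultracharge I) (S : ∀ i, MetricPrestructure L (M i))

theorem toUltramean_const (c : ℝ) (z : Ultramean P S) :
    (const M c).toUltramean P S z = c := P.integral_const c

theorem toUltramean_add (f g : LipschitzFamily M) (z : Ultramean P S) :
    (f.add g).toUltramean P S z = f.toUltramean P S z + g.toUltramean P S z :=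
  P.integral_add (P.isIntegrable fun i => f.abs_le_bound i _)
    (P.isIntegrable fun i => g.abs_le_bound i _)

theorem toUltramean_smul (r : ℝ) (f : LipschitzFamily M) (z : Ultramean P S) :
    (f.smul r).toUltramean P S z = r * f.toUltramean P S z :=
  P.integral_const_mul (P.isIntegrable fun i => f.abs_le_bound i _) r

theorem abs_toUltramean_le (f : LipschitzFamily M) (z : Ultramean P S) :
    |f.toUltramean P S z| ≤ f.bound :=
  P.abs_integral_le fun i => f.abs_le_bound i _

theorem lipschitzWith_toUltramean (f : LipschitzFamily M) :
    LipschitzWith f.lip (f.toUltramean P S) := by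
  refine LipschitzWith.of_le_add_mul f.lip fun y z => ?_
  rw [Ultramean.dist_eq]
  have := P.integral_le_of_le (n := 1)
    (h := fun _ i => dist (Ultramean.rep P S y i) (Ultramean.rep P S z i))
    (fun i => f.abs_le_bound i (Ultramean.rep P S y i))
    (fun i => f.abs_le_bound i (Ultramean.rep P S z i))
    (fun _ i => (S i).abs_dist_le _ _) f.lip.2 (fun i => by
      have h := (abs_le.1 ((f.lipschitzWith i).dist_le_mul (Ultramean.rep P S y i)
        (Ultramean.rep P S z i))).2
      have e : ((f.lip).1 : ℝ) = (f.lip : ℝ) := rfl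
      simp only [Finset.univ_unique, Finset.sum_const, Finset.card_singleton, one_smul, e]
      linarith)
  simpa [toUltramean] using this

/-- The function `[fᵢ]` as a bounded continuous function on the ultramean. -/
noncomputable def toBoundedContinuousFunction (f : LipschitzFamily M) :
    BoundedContinuousFunction (Ultramean P S) ℝ :=
  BoundedContinuousFunction.ofNormedAddCommGroup (f.toUltramean P S)
    (f.lipschitzWith_toUltramean P S).continuous f.bound (f.abs_toUltramean_le P S)

end toUltramean

variable (P : Ultracharge I) (S : ∀ i, Prestructure L (M i))

/-- The iterated integral `∫ (∫ fᵢ dμᵢ) dP`. -/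
noncomputable def iteratedIntegral (f : LipschitzFamily M) : ℝ :=
  P.integral fun i => (S i).charge.integral (f.toFun i)

theorem isIntegrable_charge (f : LipschitzFamily M) (i : I) :
    (S i).charge.IsIntegrable (f.toFun i) :=
  BorelCharge.isIntegrable _ (f.lipschitzWith i).continuous (f.abs_le_bound i)

theorem isIntegrable_integral (f : LipschitzFamily M) :
    P.IsIntegrable fun i => (S i).charge.integral (f.toFun i) :=
  P.isIntegrable fun i => (S i).charge.abs_integral_le (f.abs_le_bound i)

theorem iteratedIntegral_const (c : ℝ) : (const M c).iteratedIntegral P S = c := by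
  simp only [iteratedIntegral, const, Charge.integral_const]

theorem iteratedIntegral_add (f g : LipschitzFamily M) :
    (f.add g).iteratedIntegral P S = f.iteratedIntegral P S + g.iteratedIntegral P S := by
  unfold iteratedIntegral
  rw [← P.integral_add (f.isIntegrable_integral P S) (g.isIntegrable_integral P S)]
  exact congrArg P.integral (funext fun i =>
    (S i).charge.integral_add (f.isIntegrable_charge S i) (g.isIntegrable_charge S i))

theorem iteratedIntegral_smul (r : ℝ) (f : LipschitzFamily M) :
    (f.smul r).iteratedIntegral P S = r * f.iteratedIntegral P S := by
  unfold iteratedIntegral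
  rw [← P.integral_const_mul (f.isIntegrable_integral P S)]
  exact congrArg P.integral (funext fun i =>
    (S i).charge.integral_const_mul (f.isIntegrable_charge S i) r)

/-- Evaluate `[fᵢ]` at a class `[xᵢ]` with `fᵢ(xᵢ) ≤ ∫ fᵢ dμᵢ + ε`. -/
theorem iteratedIntegral_nonneg (f : LipschitzFamily M)
    (hf : ∀ z : UltrameanSpace P S, 0 ≤ f.toUltramean P _ z) : 0 ≤ f.iteratedIntegral P S := by
  refine le_of_forall_pos_le_add fun ε hε => ?_
  have hx : ∀ i, ∃ x, f.toFun i x ≤ (S i).charge.integral (f.toFun i) + ε := fun i => by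
    by_contra! h
    have := le_csSup ((S i).charge.bddAbove_lowerSums fun y => (abs_le.1 (f.abs_le_bound i y)).2)
      ((S i).charge.const_mem_lowerSums fun y => (h y).le)
    unfold Charge.integral Charge.lowerIntegral at this
    linarith
  choose x hx using hx
  have h := hf (ultrameanClass P S x)
  rw [ultrameanClass, toUltramean_mk] at h
  exact h.trans (P.integral_le_integral_add_const (fun i => f.abs_le_bound i (x i))
    (fun i => (S i).charge.abs_integral_le (f.abs_le_bound i)) hx)

end LipschitzFamily

variable (P : Ultracharge I) (S : ∀ i, Prestructure L (M i))

/-- The graph of the functional `[fᵢ] ↦ ∫ (∫ fᵢ dμᵢ) dP`. -/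
def iteratedIntegralGraph :
    Submodule ℝ (BoundedContinuousFunction (UltrameanSpace P S) ℝ × ℝ) where
  carrier := {p | ∃ f : LipschitzFamily M, (∀ z, p.1 z = f.toUltramean P _ z) ∧
    p.2 = f.iteratedIntegral P S}
  zero_mem' := ⟨LipschitzFamily.const M 0,
    fun z => (LipschitzFamily.toUltramean_const P _ 0 z).symm,
    (LipschitzFamily.iteratedIntegral_const P S 0).symm⟩
  add_mem' := by
    rintro p q ⟨f, hf, hf'⟩ ⟨g, hg, hg'⟩
    refine ⟨f.add g, fun z => ?_, ?_⟩
    · rw [LipschitzFamily.toUltramean_add, ← hf, ← hg]; rfl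
    · rw [LipschitzFamily.iteratedIntegral_add, ← hf', ← hg']; rfl
  smul_mem' := by
    rintro r p ⟨f, hf, hf'⟩
    refine ⟨f.smul r, fun z => ?_, ?_⟩
    · rw [LipschitzFamily.toUltramean_smul, ← hf]; rfl
    · rw [LipschitzFamily.iteratedIntegral_smul, ← hf']; rfl

theorem iteratedIntegralGraph_nonneg
    {p : BoundedContinuousFunction (UltrameanSpace P S) ℝ × ℝ}
    (hp : p ∈ iteratedIntegralGraph P S) (h : ∀ z, 0 ≤ p.1 z) : 0 ≤ p.2 := by
  obtain ⟨f, hf, hf'⟩ := hp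
  rw [hf']
  exact f.iteratedIntegral_nonneg P S fun z => hf z ▸ h z

theorem iteratedIntegralGraph_eq_zero
    (p : BoundedContinuousFunction (UltrameanSpace P S) ℝ × ℝ)
    (hp : p ∈ iteratedIntegralGraph P S) (h : p.1 = 0) : p.2 = 0 := by
  have h1 := iteratedIntegralGraph_nonneg P S hp fun z => by simp [h]
  have h2 := iteratedIntegralGraph_nonneg P S (neg_mem hp) fun z => by simp [h]
  rw [Prod.snd_neg] at h2
  linarith

/-- The functional `[fᵢ] ↦ ∫ (∫ fᵢ dμᵢ) dP` is positive and its domain contains the constants, so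
that the extension theorem of M. Riesz applies. -/
theorem exists_isPositiveExtension :
    ∃ Φ : BoundedContinuousFunction (UltrameanSpace P S) ℝ →ₗ[ℝ] ℝ, IsPositiveExtension P S Φ := by
  let s : PointedCone ℝ (BoundedContinuousFunction (UltrameanSpace P S) ℝ) :=
    { carrier := {g | ∀ z, 0 ≤ g z}
      zero_mem' := fun _ => le_rfl
      add_mem' := fun ha hb z => add_nonneg (ha z) (hb z)
      smul_mem' := fun r _ ha z => mul_nonneg r.2 (ha z) }
  let Λ := (iteratedIntegralGraph P S).toLinearPMap
  have hmem : ∀ f : LipschitzFamily M,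
      (f.toBoundedContinuousFunction P _, f.iteratedIntegral P S) ∈ iteratedIntegralGraph P S :=
    fun f => ⟨f, fun _ => rfl, rfl⟩
  have hgraph : ∀ y : Λ.domain, ((y : BoundedContinuousFunction _ ℝ), Λ y) ∈
      iteratedIntegralGraph P S := fun y =>
    Submodule.mem_graph_toLinearPMap (iteratedIntegralGraph_eq_zero P S) y
  obtain ⟨Φ, hΦ, hpos⟩ := riesz_extension s Λ
    (fun y hy => iteratedIntegralGraph_nonneg P S (hgraph y) hy) fun g =>
      ⟨⟨_, Submodule.mem_map_of_mem (hmem (LipschitzFamily.const M ‖g‖))⟩, fun z => by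
        have h1 := (abs_le.1 (g.norm_coe_le_norm z)).1
        change 0 ≤ (LipschitzFamily.const M ‖g‖).toUltramean P _ z + g z
        rw [LipschitzFamily.toUltramean_const]
        linarith⟩
  refine ⟨Φ, hpos, fun f g hg => ?_⟩
  have hg' : g = f.toBoundedContinuousFunction P _ := by
    ext z
    exact hg z
  have hd : g ∈ Λ.domain := hg' ▸ Submodule.mem_map_of_mem (hmem f)
  have h2 := sub_mem (hgraph ⟨g, hd⟩) (hmem f)
  have h3 := iteratedIntegralGraph_eq_zero P S _ h2 (sub_eq_zero.2 hg')
  exact (hΦ ⟨g, hd⟩).trans (sub_eq_zero.1 h3)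

variable {P S}

theorem IsPositiveExtension.isNormalizedPositive
    {Φ : BoundedContinuousFunction (UltrameanSpace P S) ℝ →ₗ[ℝ] ℝ}
    (hΦ : IsPositiveExtension P S Φ) : IsNormalizedPositive Φ where
  nonneg := hΦ.nonneg
  map_one := (hΦ.extends_family (LipschitzFamily.const M 1) 1 fun z =>
    (LipschitzFamily.toUltramean_const P _ 1 z).symm).trans
      (LipschitzFamily.iteratedIntegral_const P S 1)

theorem IsPositiveExtension.isUltrameanCharge
    {Φ : BoundedContinuousFunction (UltrameanSpace P S) ℝ →ₗ[ℝ] ℝ}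
    (hΦ : IsPositiveExtension P S Φ) :
    IsUltrameanCharge P S hΦ.isNormalizedPositive.borelCharge where
  isRegular := hΦ.isNormalizedPositive.borelCharge_isRegular
  integral_eq f :=
    (hΦ.isNormalizedPositive.borelCharge_integral (f.toBoundedContinuousFunction P _)).trans
      (hΦ.extends_family f _ fun _ => rfl)

end PositiveExtension

/-! ### Uniform bounds and Lipschitz constants of formulas -/

section UniformBounds

universe u v w

variable {L : LipschitzLanguage.{u, v}}

theorem exists_termValue_lipschitz {n : ℕ} (t : L.toLanguage.Term (Fin n)) :
    ∃ K : ℝ≥0, ∀ (M : Type w) [PseudoMetricSpace M] (S : MetricPrestructure L M) (a b : Fin n → M),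
      dist (S.termValue a t) (S.termValue b t) ≤ K * ∑ k, dist (a k) (b k) := by
  induction t with
  | var k =>
    refine ⟨1, fun M _ S a b => ?_⟩
    rw [NNReal.coe_one, one_mul]
    exact Finset.single_le_sum (f := fun k => dist (a k) (b k)) (fun _ _ => dist_nonneg)
      (Finset.mem_univ k)
  | func F t ih =>
    choose K hK using ih
    refine ⟨L.funLip F * ∑ j, K j, fun M _ S a b => ?_⟩
    refine (S.dist_funMap_le F _ _).trans ?_
    push_cast
    rw [mul_assoc, Finset.sum_mul]
    exact mul_le_mul_of_nonneg_left (Finset.sum_le_sum fun j _ => hK j M S a b) (L.funLip F).2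

theorem sum_dist_snoc {M : Type w} [PseudoMetricSpace M] {n : ℕ} (a b : Fin n → M) (c d : M) :
    ∑ k, dist (Fin.snoc (α := fun _ => M) a c k) (Fin.snoc (α := fun _ => M) b d k) =
      ∑ k, dist (a k) (b k) + dist c d := by
  simp [Fin.sum_univ_castSucc]

/-- Every formula has a bound and a Lipschitz constant that serve for all prestructures at once. -/
theorem exists_value_bound_lipschitz {n : ℕ} (φ : Formula L n) :
    ∃ (B : ℝ) (K : ℝ≥0), ∀ (M : Type w) [PseudoMetricSpace M] (S : Prestructure L M),
      (∀ a, |S.value φ a| ≤ B) ∧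
      ∀ a b, S.value φ a ≤ S.value φ b + K * ∑ k, dist (a k) (b k) := by
  induction φ with
  | one => exact ⟨1, 0, fun M _ S => ⟨fun a => by simp [Prestructure.value],
      fun a b => by simp [Prestructure.value]⟩⟩
  | rel R t =>
    choose K hK using fun j => exists_termValue_lipschitz.{u, v, w} (t j)
    refine ⟨1, L.relLip R * ∑ j, K j, fun M _ S => ⟨fun a => S.abs_relMap_le R _, fun a b => ?_⟩⟩
    have h1 := (abs_le.1 (S.dist_relMap_le R (fun j => S.termValue a (t j))
      fun j => S.termValue b (t j))).2
    have h2 := mul_le_mul_of_nonneg_left (Finset.sum_le_sum fun j (_ : j ∈ Finset.univ) =>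
      hK j M S.toMetricPrestructure a b) (L.relLip R).coe_nonneg
    rw [← Finset.sum_mul, ← mul_assoc] at h2
    push_cast
    simp only [Prestructure.value]
    linarith
  | dist s t =>
    obtain ⟨K, hK⟩ := exists_termValue_lipschitz.{u, v, w} s
    obtain ⟨K', hK'⟩ := exists_termValue_lipschitz.{u, v, w} t
    refine ⟨1, K + K', fun M _ S => ⟨fun a => S.abs_dist_le _ _, fun a b => ?_⟩⟩
    have h1 := hK M S.toMetricPrestructure a b
    have h2 := hK' M S.toMetricPrestructure a b
    have h3 := dist_triangle4 (S.termValue a s) (S.termValue b s) (S.termValue b t)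
      (S.termValue a t)
    rw [dist_comm (S.termValue b t)] at h3
    push_cast
    simp only [Prestructure.value]
    linarith
  | add φ ψ ih₁ ih₂ =>
    obtain ⟨B, K, h⟩ := ih₁
    obtain ⟨B', K', h'⟩ := ih₂
    refine ⟨B + B', K + K', fun M _ S => ⟨fun a =>
      (abs_add_le _ _).trans (add_le_add ((h M S).1 a) ((h' M S).1 a)), fun a b => ?_⟩⟩
    have h1 := (h M S).2 a b
    have h2 := (h' M S).2 a b
    push_cast
    simp only [Prestructure.value]
    linarith
  | smul r φ ih =>
    obtain ⟨B, K, h⟩ := ih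
    refine ⟨|r| * B, ‖r‖₊ * K, fun M _ S => ⟨fun a => ?_, fun a b => ?_⟩⟩
    · simp only [Prestructure.value, abs_mul]
      exact mul_le_mul_of_nonneg_left ((h M S).1 a) (abs_nonneg r)
    · have h1 := (h M S).2 a b
      have h2 := (h M S).2 b a
      simp only [dist_comm (b _)] at h2
      have h3 : |S.value φ a - S.value φ b| ≤ K * ∑ k, dist (a k) (b k) :=
        abs_le.2 ⟨by linarith, by linarith⟩
      have h4 := mul_le_mul_of_nonneg_left h3 (abs_nonneg r)
      rw [← abs_mul] at h4
      have h5 := (le_abs_self _).trans h4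
      simp only [Prestructure.value, NNReal.coe_mul, coe_nnnorm, Real.norm_eq_abs]
      linarith
  | inf φ ih =>
    obtain ⟨B, K, h⟩ := ih
    refine ⟨B, K, fun M _ S => ?_⟩
    have := S.charge.nonempty
    have hbdd : ∀ a, BddBelow (range fun c => S.value φ (Fin.snoc a c)) := fun a =>
      ⟨-B, by rintro _ ⟨c, rfl⟩; exact (abs_le.1 ((h M S).1 _)).1⟩
    refine ⟨fun a => abs_le.2 ⟨le_ciInf fun c => (abs_le.1 ((h M S).1 _)).1, ?_⟩, fun a b => ?_⟩
    · exact (ciInf_le (hbdd a) (Classical.arbitrary M)).trans (abs_le.1 ((h M S).1 _)).2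
    · rw [← sub_le_iff_le_add]
      refine le_ciInf fun c => ?_
      have h1 := (h M S).2 (Fin.snoc a c) (Fin.snoc b c)
      rw [sum_dist_snoc, dist_self, add_zero] at h1
      have h2 := ciInf_le (hbdd a) c
      simp only [Prestructure.value]
      linarith
  | sup φ ih =>
    obtain ⟨B, K, h⟩ := ih
    refine ⟨B, K, fun M _ S => ?_⟩
    have := S.charge.nonempty
    have hbdd : ∀ a, BddAbove (range fun c => S.value φ (Fin.snoc a c)) := fun a =>
      ⟨B, by rintro _ ⟨c, rfl⟩; exact (abs_le.1 ((h M S).1 _)).2⟩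
    refine ⟨fun a => abs_le.2 ⟨?_, ciSup_le fun c => (abs_le.1 ((h M S).1 _)).2⟩, fun a b => ?_⟩
    · exact (abs_le.1 ((h M S).1 _)).1.trans (le_ciSup (hbdd a) (Classical.arbitrary M))
    · refine ciSup_le fun c => ?_
      have h1 := (h M S).2 (Fin.snoc a c) (Fin.snoc b c)
      rw [sum_dist_snoc, dist_self, add_zero] at h1
      have h2 := le_ciSup (hbdd b) c
      simp only [Prestructure.value]
      linarith
  | int φ ih =>
    obtain ⟨B, K, h⟩ := ih
    refine ⟨B, K, fun M _ S => ⟨fun a => S.charge.abs_integral_le fun c => (h M S).1 _,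
      fun a b => ?_⟩⟩
    refine S.charge.integral_le_integral_add_const (fun c => (h M S).1 _)
      (fun c => (h M S).1 _) fun c => ?_
    have h1 := (h M S).2 (Fin.snoc a c) (Fin.snoc b c)
    rwa [sum_dist_snoc, dist_self, add_zero] at h1

end UniformBounds

/-! ### Values of formulas in the ultramean -/

section Values

universe u v w x

variable {L : LipschitzLanguage.{u, v}} {I : Type w} {M : I → Type x}

/-- Choosing almost minimal points of all the `f i` commutes infimum and integration over `I`. -/
theorem Ultracharge.iInf_eq_integral_iInf (P : Ultracharge I) [∀ i, Nonempty (M i)] {Z : Type*}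
    {m : (∀ i, M i) → Z} (hm : Function.Surjective m) {g : Z → ℝ} {f : ∀ i, M i → ℝ} {B : ℝ}
    (hB : ∀ i y, |f i y| ≤ B) (hg : ∀ b, g (m b) = P.integral fun i => f i (b i)) :
    ⨅ z, g z = P.integral fun i => ⨅ y, f i y := by
  have : Nonempty Z := ⟨m fun i => Classical.arbitrary (M i)⟩
  have hbdd : ∀ i, BddBelow (range (f i)) := fun i =>
    ⟨-B, by rintro _ ⟨y, rfl⟩; exact (abs_le.1 (hB i y)).1⟩
  have hbdd' : BddBelow (range g) := by
    refine ⟨-B, ?_⟩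
    rintro _ ⟨z, rfl⟩
    obtain ⟨b, rfl⟩ := hm z
    rw [hg]
    exact (abs_le.1 (P.abs_integral_le fun i => hB i (b i))).1
  have hinf : ∀ i, |⨅ y, f i y| ≤ B := fun i => abs_le.2
    ⟨le_ciInf fun y => (abs_le.1 (hB i y)).1, (ciInf_le (hbdd i) (Classical.arbitrary (M i))).trans
      (abs_le.1 (hB i _)).2⟩
  refine le_antisymm (le_of_forall_pos_le_add fun ε hε => ?_) (le_ciInf fun z => ?_)
  · choose b hb using fun i => exists_lt_of_ciInf_lt (lt_add_of_pos_right (⨅ y, f i y) hε)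
    exact (ciInf_le hbdd' (m b)).trans ((hg b).le.trans
      (P.integral_le_integral_add_const (fun i => hB i (b i)) hinf fun i => (hb i).le))
  · obtain ⟨b, rfl⟩ := hm z
    rw [hg]
    exact P.integral_mono hinf (fun i => hB i (b i)) fun i => ciInf_le (hbdd i) (b i)

theorem iInf_neg_eq {ι : Sort*} (q : ι → ℝ) : ⨅ z, -q z = -⨆ z, q z := by
  rw [iInf, iSup, Real.sInf_def, Set.neg_range]
  simp

theorem Ultracharge.iSup_eq_integral_iSup (P : Ultracharge I) [∀ i, Nonempty (M i)] {Z : Type*}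
    {m : (∀ i, M i) → Z} (hm : Function.Surjective m) {g : Z → ℝ} {f : ∀ i, M i → ℝ} {B : ℝ}
    (hB : ∀ i y, |f i y| ≤ B) (hg : ∀ b, g (m b) = P.integral fun i => f i (b i)) :
    ⨆ z, g z = P.integral fun i => ⨆ y, f i y := by
  have hneg : ∀ i y, |-f i y| ≤ B := fun i y => (abs_neg _).le.trans (hB i y)
  have h := P.iInf_eq_integral_iInf hm (g := fun z => -g z) hneg fun b => by
    rw [hg, P.integral_neg (P.isIntegrable fun i => hB i (b i))]
  have hsup : ∀ i, |⨆ y, f i y| ≤ B := fun i => abs_le.2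
    ⟨(abs_le.1 (hB i (Classical.arbitrary (M i)))).1.trans
      (le_ciSup (f := f i) ⟨B, by rintro _ ⟨y, rfl⟩; exact (abs_le.1 (hB i y)).2⟩ _),
      ciSup_le fun y => (abs_le.1 (hB i y)).2⟩
  simp only [iInf_neg_eq] at h
  rw [P.integral_neg (P.isIntegrable hsup)] at h
  exact neg_inj.1 h

variable [∀ i, PseudoMetricSpace (M i)]

theorem Ultramean.termValue_mk (P : Ultracharge I) (S : ∀ i, MetricPrestructure L (M i)) {n : ℕ}
    (t : L.toLanguage.Term (Fin n)) (a : Fin n → ∀ i, M i) :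
    (Ultramean.metricPrestructure P S).termValue (fun k => Ultramean.mk P S (a k)) t =
      Ultramean.mk P S fun i => (S i).termValue (fun k => a k i) t := by
  induction t with
  | var k => rfl
  | func F t ih =>
    simp only [MetricPrestructure.termValue, ih]
    exact Ultramean.funMap_mk P S F fun j i => (S i).termValue (fun k => a k i) (t j)

variable (P : Ultracharge I) (S : ∀ i, Prestructure L (M i))

theorem isIntegrable_value {n : ℕ} (φ : Formula L n) (a : ∀ i, Fin n → M i) :
    P.IsIntegrable fun i => (S i).value φ (a i) := by
  obtain ⟨B, K, h⟩ := exists_value_bound_lipschitz.{u, v, x} φ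
  exact P.isIntegrable fun i => (h (M i) (S i)).1 (a i)

/-- The functions `y ↦ φ^{Mᵢ}(aᵢ, y)` form a Lipschitz family. -/
theorem exists_lipschitzFamily_value {n : ℕ} (φ : Formula L (n + 1)) (a : ∀ i, Fin n → M i) :
    ∃ f : LipschitzFamily M, ∀ i y, f.toFun i y = (S i).value φ (Fin.snoc (a i) y) := by
  obtain ⟨B, K, h⟩ := exists_value_bound_lipschitz.{u, v, x} φ
  refine ⟨⟨fun i y => (S i).value φ (Fin.snoc (a i) y), K, B, fun i => ?_,
    fun i y => (h (M i) (S i)).1 _⟩, fun _ _ => rfl⟩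
  refine LipschitzWith.of_le_add_mul K fun y z => ?_
  have h1 := (h (M i) (S i)).2 (Fin.snoc (a i) y) (Fin.snoc (a i) z)
  rw [sum_dist_snoc] at h1
  simpa using h1

/-- The mean theorem for formulas, by induction on the formula: infima and suprema over the
ultramean are computed by almost extremal representatives, and integrals over the ultramean by the
defining property of the charge `μ`, applied to the Lipschitz family given by the formula. -/
theorem ultrameanPrestructure_value (μ : BorelCharge (UltrameanSpace P S))
    (hμ : IsUltrameanCharge P S μ) {n : ℕ} (φ : Formula L n) (a : Fin n → ∀ i, M i) :
    (ultrameanPrestructure P S μ hμ).value φ (fun k => ultrameanClass P S (a k)) =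
      P.integral fun i => (S i).value φ fun k => a k i := by
  have hsurj : Function.Surjective (ultrameanClass P S) := fun z =>
    ⟨_, Ultramean.mk_rep P (fun i => (S i).toMetricPrestructure) z⟩
  have hne : ∀ i, Nonempty (M i) := fun i => (S i).charge.nonempty
  -- The value at a tuple extended by the class of `b`, in the form needed for the quantifiers.
  have hsnoc : ∀ {n : ℕ} (φ : Formula L (n + 1)) (a : Fin n → ∀ i, M i) (b : ∀ i, M i),
      ((∀ a : Fin (n + 1) → ∀ i, M i,
        (ultrameanPrestructure P S μ hμ).value φ (fun k => ultrameanClass P S (a k)) =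
          P.integral fun i => (S i).value φ fun k => a k i)) →
      (ultrameanPrestructure P S μ hμ).value φ
        (Fin.snoc (fun k => ultrameanClass P S (a k)) (ultrameanClass P S b)) =
        P.integral fun i => (S i).value φ (Fin.snoc (fun k => a k i) (b i)) := by
    intro n φ a b ih
    have h := ih (Fin.snoc (α := fun _ => ∀ i, M i) a b)
    have e1 := Fin.comp_snoc (ultrameanClass P S) a b
    have e2 := fun i => Fin.comp_snoc (fun c : ∀ i, M i => c i) a b
    simp only [Function.comp_def] at e1 e2
    rw [e1] at h
    simpa only [e2] using h
  induction φ with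
  | one => exact (P.integral_const 1).symm
  | rel R t =>
    simp only [Prestructure.value]
    refine Eq.trans ?_ (Ultramean.relMap_mk P (fun i => (S i).toMetricPrestructure) R
      fun j i => (S i).termValue (fun k => a k i) (t j))
    exact congrArg _ (funext fun j => Ultramean.termValue_mk P _ (t j) a)
  | dist s t =>
    simp only [Prestructure.value]
    exact congrArg₂ dist (Ultramean.termValue_mk P _ s a) (Ultramean.termValue_mk P _ t a)
  | add φ ψ ih₁ ih₂ =>
    simp only [Prestructure.value, ih₁, ih₂]
    exact (P.integral_add (isIntegrable_value P S φ _) (isIntegrable_value P S ψ _)).symm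
  | smul r φ ih =>
    simp only [Prestructure.value, ih]
    exact (P.integral_const_mul (isIntegrable_value P S φ _) r).symm
  | inf φ ih =>
    obtain ⟨f, hf⟩ := exists_lipschitzFamily_value S φ fun i k => a k i
    simp only [Prestructure.value]
    exact P.iInf_eq_integral_iInf hsurj (fun i y => hf i y ▸ f.abs_le_bound i y)
      fun b => hsnoc φ a b ih
  | sup φ ih =>
    obtain ⟨f, hf⟩ := exists_lipschitzFamily_value S φ fun i k => a k i
    simp only [Prestructure.value]
    exact P.iSup_eq_integral_iSup hsurj (fun i y => hf i y ▸ f.abs_le_bound i y)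
      fun b => hsnoc φ a b ih
  | int φ ih =>
    obtain ⟨f, hf⟩ := exists_lipschitzFamily_value S φ fun i k => a k i
    have hf' : ∀ i, f.toFun i = fun y => (S i).value φ (Fin.snoc (fun k => a k i) y) :=
      fun i => funext (hf i)
    have h := hμ.integral_eq f
    simp only [hf'] at h
    simp only [Prestructure.value]
    rw [← h]
    refine congrArg μ.integral (funext fun z => ?_)
    obtain ⟨b, rfl⟩ := hsurj z
    refine (hsnoc φ a b ih).trans ?_
    rw [ultrameanClass, LipschitzFamily.toUltramean_mk]
    simp only [hf]

theorem isElementaryEmbedding_diagonal {N : Type x} [PseudoMetricSpace N] (S : Prestructure L N)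
    (μ : BorelCharge (UltrameanSpace P fun _ : I => S))
    (hμ : IsUltrameanCharge P (fun _ : I => S) μ) :
    IsElementaryEmbedding S (ultrameanPrestructure P (fun _ : I => S) μ hμ)
      fun a => ultrameanClass P (fun _ : I => S) fun _ => a := fun _ φ a =>
  ((ultrameanPrestructure_value P (fun _ => S) μ hμ φ fun k _ => a k).trans
    (P.integral_const _)).symm

end Values

end AffineIntegration

theorem mainTheorem2 (L : LipschitzLanguage) {I : Type*} (P : Ultracharge I) :
    (∀ (M : I → Type*) [∀ i, MetricSpace (M i)] [∀ i, CompleteSpace (M i)]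
      (S : ∀ i, Prestructure L (M i)),
      (∃ Φ : BoundedContinuousFunction (UltrameanSpace P S) ℝ →ₗ[ℝ] ℝ,
        IsPositiveExtension P S Φ) ∧
      (∀ Φ : BoundedContinuousFunction (UltrameanSpace P S) ℝ →ₗ[ℝ] ℝ,
        IsPositiveExtension P S Φ →
        ∃ μ : BorelCharge (UltrameanSpace P S), IsUltrameanCharge P S μ ∧
          ∀ g : BoundedContinuousFunction (UltrameanSpace P S) ℝ, μ.integral g = Φ g) ∧
      ∀ (μ : BorelCharge (UltrameanSpace P S)) (hμ : IsUltrameanCharge P S μ)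
        (n : ℕ) (φ : Formula L n) (a : Fin n → ∀ i, M i),
        P.IsIntegrable (fun i => (S i).value φ fun k => a k i) ∧
        (ultrameanPrestructure P S μ hμ).value φ (fun k => ultrameanClass P S (a k)) =
          P.integral fun i => (S i).value φ fun k => a k i) ∧
    (∀ (N : Type*) [MetricSpace N] [CompleteSpace N] (S : Prestructure L N)
      (μ : BorelCharge (UltrameanSpace P fun _ : I => S))
      (hμ : IsUltrameanCharge P (fun _ : I => S) μ),
      IsElementaryEmbedding S (ultrameanPrestructure P (fun _ : I => S) μ hμ)
        fun a => ultrameanClass P (fun _ : I => S) fun _ => a) := by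
  refine ⟨fun M _ _ S => ⟨exists_isPositiveExtension P S, fun Φ hΦ =>
      ⟨_, hΦ.isUltrameanCharge, hΦ.isNormalizedPositive.borelCharge_integral⟩,
    fun μ hμ n φ a => ⟨isIntegrable_value P S φ fun i k => a k i,
      ultrameanPrestructure_value P S μ hμ φ a⟩⟩,
    fun N _ _ S μ hμ => isElementaryEmbedding_diagonal P S μ hμ⟩
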